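/- **Theorem 5.** Two bodies of masses $m_1\le m_2$ move in $\mathbb R^3$, attracted by a fixed centre at the origin. Let $\mu_i=m_i/(m_1+m_2)$. A state $(\mathbf x_i,\mathbf v_i)$, $\mathbf x_i\ne0$, of body $i$ determines a Keplerian orbit with specific energy $E_i=\frac12|\mathbf v_i|^2-1/|\mathbf x_i|$, specific angular momentum $\mathbf L_i=\mathbf x_i\wedge\mathbf v_i$ and eccentricity $e_i=\sqrt{1+2E_i|\mathbf L_i|^2}$; it is called elliptic if $E_i<0$ and $\mathbf L_i\neq0$. Put $\mathbf L=\mu_1\mathbf L_1+\mu_2\mathbf L_2$ and $$\sigma=\sigma(\mu_1,\mu_2)=-\frac{(1-e^2)(\mu_1^2+\mu_2^2e)^2}{2\mu_2e^2},\qquad e=\tfrac14\Big(\sqrt{(\mu_1/\mu_2)^4+8(\mu_1/\mu_2)^2}-(\mu_1/\mu_2)^2\Big).$$ A collision with unit normal $\mathbf n$ and inelasticity $\varepsilon\in[0,\frac12]$ conserves $\mu_1\mathbf v_1+\mu_2\mathbf v_2$ and the tangential part of $\mathbf w=\mathbf v_1-\mathbf v_2$, and multiplies $\mathbf w\cdot\mathbf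 n$ by $-(1-2\varepsilon)$. Let $E$ and $\ell$ be real numbers with $E\ell^2<\sigma$. 1. *(Dynamics of the orbits.)* The state is a pair of intersecting Keplerian orbits; in one step one chooses a common point of the two orbits, an arbitrary unit vector $\mathbf n$ and an arbitrary $\varepsilon\in[0,\frac12]$, and replaces the orbits by those of the particles coming out of the collision, at that point, of two particles moving on the two orbits. There are constants $c_1,c_2<1$ and $B$, depending only on $\mu_1,\mu_2,E,\ell$, such that, if two intersecting orbits satisfy initially $\mu_1E_1+\mu_2E_2=E$ and $|\mathbf L|=\ell$, then initially and after any finite number of steps the orbits intersect, $(\mu_1E_1+\mu_2E_2)|\mathbf L|^2<\sigma$, and both orbits are elliptic, with $e_i\le c_i$ and $|\mathbf L_i|\le B$. 2. *(Hard spheres.)* There are $D_0>0$, $c_1,c_2<1$ and $B$, depending only on $m_1,m_2,E,\ell$, such that the following holds for two hard spheres with radii $R_1,R_2\geq 0$ and $0<D=R_1+R_2\le D_0$. They move on Keplerian orbits, at distance $|\mathbf x_1-\mathbf x_2|\ge D$, except for collisions (finitely many in bounded time, possibly with different $\varepsilon\in[0,\frac12]$), which take place at distance $D$, with $\mathbf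 n=(\mathbf x_1-\mathbf x_2)/D$ and incoming velocities, $\mathbf n\cdot\mathbf w<0$. If initially both orbits are elliptic, $\mu_1E_1+\mu_2E_2=E$ and $|\mathbf L|=\ell$, then at all later times of the motion $(\mu_1E_1+\mu_2E_2)|\mathbf L|^2<\sigma$ and both orbits are elliptic, with $e_i\le\max(c_i,e_i(0))$ and $|\mathbf L_i|\le\max(B,|\mathbf L_i(0)|)$. 3. *(Short-range potential.)* There are $D_0,U_0>0$, $c_1,c_2<1$ and $B$, depending only on $m_1,m_2,E,\ell$, such that the following holds for two point particles which interact with a potential energy $V(|\mathbf x_1-\mathbf x_2|)$, where $V(r)=0$ for $r\ge D$, $V\ge-U$, $0<D\le D_0$ and $0\le U\le U_0$. If at time $0$ the orbits determined by $(\mathbf x_i,\mathbf v_i)$ are elliptic, $|\mathbf L|=\ell$ and the total specific energy $\mu_1E_1+\mu_2E_2+V(|\mathbf x_1-\mathbf x_2|)/(m_1+m_2)$ is $E$, then at all times of the motion the product of the total specific energy and $|\mathbf L|^2$ is less than $\sigma$, and the orbits determined by $(\mathbf x_i,\mathbf v_i)$ are elliptic, with $e_i\le\max(c_i,e_i(0))$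 and $|\mathbf L_i|\le\max(B,|\mathbf L_i(0)|)$; moreover the positions of the particles remain bounded. -/

import Mathlib

open scoped RealInnerProductSpace Topology

noncomputable section

namespace KeplerCollisions

/-- Euclidean three-dimensional space; the attracting centre is the origin. -/
abbrev E3 : Type := EuclideanSpace ℝ (Fin 3)

/-- The cross product of two vectors. -/
def cross (a b : E3) : E3 := WithLp.toLp 2 (crossProduct a.ofLp b.ofLp)

/-- Specific energy of a body at position `x` with velocity `v`, in the potential `-1/|x|`. -/
def energy (x v : E3) : ℝ := ‖v‖ ^ 2 / 2 - 1 / ‖x‖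

/-- Specific angular momentum vector. -/
def angMom (x v : E3) : E3 := cross x v

/-- The eccentricity (Laplace-Runge-Lenz) vector: it points to the periapsis, and its length is
the eccentricity. -/
def eccVec (x v : E3) : E3 := cross v (cross x v) - ‖x‖⁻¹ • x

/-- The elements of a Keplerian orbit in space: specific energy, specific angular momentum and
eccentricity vector. They fix the conic, its position in space and the motion along it. -/
@[ext]
structure Orbit where
  energy : ℝ
  angMom : E3
  eccVec : E3

/-- The (osculating) Keplerian orbit through the position `x` with velocity `v`. -/
def osculating (x v : E3) : Orbit := ⟨energy x v, angMom x v, eccVec x v⟩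

/-- The orbit `o` passes through the position `x`, with velocity `v`. -/
def Orbit.Passes (o : Orbit) (x v : E3) : Prop := x ≠ 0 ∧ osculating x v = o

/-- The eccentricity `√(1 + 2 E |L|²)`. -/
def Orbit.ecc (o : Orbit) : ℝ := √(1 + 2 * o.energy * ‖o.angMom‖ ^ 2)

/-- The orbit is an ellipse (circles included): negative energy, and not degenerate to a
segment. -/
def Orbit.IsElliptic (o : Orbit) : Prop := o.energy < 0 ∧ o.angMom ≠ 0

/-- `o` is an ellipse whose eccentricity and angular momentum are at most `c` and `B`, or at most
those of the reference orbit `o₀`. -/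
def Orbit.Controlled (c B : ℝ) (o₀ o : Orbit) : Prop :=
  o.IsElliptic ∧ o.ecc ≤ max c o₀.ecc ∧ ‖o.angMom‖ ≤ max B ‖o₀.angMom‖

/-- Two orbits intersect: they have a common position. -/
def Intersect (o₁ o₂ : Orbit) : Prop := ∃ p u₁ u₂ : E3, o₁.Passes p u₁ ∧ o₂.Passes p u₂

/-- The mean energy `μ₁ E₁ + μ₂ E₂` of a couple of orbits. -/
def meanEnergy (μ₁ μ₂ : ℝ) (o₁ o₂ : Orbit) : ℝ := μ₁ * o₁.energy + μ₂ * o₂.energy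

/-- The mean angular momentum vector `μ₁ L₁ + μ₂ L₂` of a couple of orbits. -/
def meanAngMom (μ₁ μ₂ : ℝ) (o₁ o₂ : Orbit) : E3 := μ₁ • o₁.angMom + μ₂ • o₂.angMom

/-- The solution in `(0,1)` of `2 μ₂² e² = μ₁² (1 - e)`. -/
def critEcc (μ₁ μ₂ : ℝ) : ℝ :=
  (√((μ₁ / μ₂) ^ 4 + 8 * (μ₁ / μ₂) ^ 2) - (μ₁ / μ₂) ^ 2) / 4

/-- The threshold `σ(μ₁, μ₂)`. -/
def sigma (μ₁ μ₂ : ℝ) : ℝ :=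
  -((1 - critEcc μ₁ μ₂ ^ 2) * (μ₁ ^ 2 + μ₂ ^ 2 * critEcc μ₁ μ₂) ^ 2
    / (2 * μ₂ * critEcc μ₁ μ₂ ^ 2))

/-- The impact rule: with unit normal `n` and inelasticity `ε`, the velocities `u₁, u₂` become
`v₁, v₂`. The tangential part of the relative velocity is kept, its normal part is multiplied by
`-(1 - 2ε)`, and the velocity of the centre of mass is conserved. -/
def ImpactRule (μ₁ μ₂ : ℝ) (n : E3) (ε : ℝ) (u₁ u₂ v₁ v₂ : E3) : Prop :=
  v₁ - v₂ = ((u₁ - u₂) - ⟪n, u₁ - u₂⟫ • n) - ((1 - 2 * ε) * ⟪n, u₁ - u₂⟫) • n ∧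
  μ₁ • v₁ + μ₂ • v₂ = μ₁ • u₁ + μ₂ • u₂

/-- One step of the dynamics of the orbits: at a common point `p` of the two orbits, fictitious
particles collide with an arbitrary unit normal `n` and an arbitrary inelasticity
`ε ∈ [0, 1/2]` (`ε = 0` is the elastic collision), and the new orbits are those of the outgoing
particles. -/
def OrbitStep (μ₁ μ₂ : ℝ) (o o' : Orbit × Orbit) : Prop :=
  ∃ (p u₁ u₂ v₁ v₂ n : E3) (ε : ℝ), o.1.Passes p u₁ ∧ o.2.Passes p u₂ ∧
    ‖n‖ = 1 ∧ 0 ≤ ε ∧ ε ≤ 1 / 2 ∧ ImpactRule μ₁ μ₂ n ε u₁ u₂ v₁ v₂ ∧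
    o' = (osculating p v₁, osculating p v₂)

/-- The acceleration due to the centre. -/
def gravity (x : E3) : E3 := -(‖x‖ ^ 3)⁻¹ • x

/-- A motion, on the time interval `I`, of two hard spheres in the field of the centre. `D` is the
sum of the radii, `x₁, x₂` are the positions of the centres of the spheres, `C` is the set of
collision times, `u₁, u₂` are the velocities just before and `v₁, v₂` those just after each time
(they agree outside `C`). The inelasticity may change from a collision to the next one. -/
structure HardSphereMotion (μ₁ μ₂ D : ℝ) (I C : Set ℝ) (x₁ x₂ u₁ u₂ v₁ v₂ : ℝ → E3) : Prop where
  ordConnected : I.OrdConnected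
  isLeast : IsLeast I 0
  subset : C ⊆ I
  locally_finite : ∀ t ∈ I, (C ∩ Set.Icc 0 t).Finite
  ne_zero : ∀ t ∈ I, x₁ t ≠ 0 ∧ x₂ t ≠ 0
  dist_ge : ∀ t ∈ I, D ≤ ‖x₁ t - x₂ t‖
  continuousOn : ContinuousOn x₁ I ∧ ContinuousOn x₂ I
  free : ∀ t ∈ I \ C, u₁ t = v₁ t ∧ u₂ t = v₂ t ∧
    HasDerivWithinAt x₁ (v₁ t) I t ∧ HasDerivWithinAt x₂ (v₂ t) I t ∧
    HasDerivWithinAt v₁ (gravity (x₁ t)) I t ∧ HasDerivWithinAt v₂ (gravity (x₂ t)) I t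
  before : ∀ t ∈ C, Filter.Tendsto v₁ (𝓝[I ∩ Set.Iio t] t) (𝓝 (u₁ t)) ∧
    Filter.Tendsto v₂ (𝓝[I ∩ Set.Iio t] t) (𝓝 (u₂ t))
  after : ∀ t ∈ C, ContinuousWithinAt v₁ (I ∩ Set.Ici t) t ∧
    ContinuousWithinAt v₂ (I ∩ Set.Ici t) t
  collision : ∀ t ∈ C, ‖x₁ t - x₂ t‖ = D ∧ ⟪D⁻¹ • (x₁ t - x₂ t), u₁ t - u₂ t⟫ < 0 ∧
    ∃ ε : ℝ, 0 ≤ ε ∧ ε ≤ 1 / 2 ∧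
      ImpactRule μ₁ μ₂ (D⁻¹ • (x₁ t - x₂ t)) ε (u₁ t) (u₂ t) (v₁ t) (v₂ t)

/-- A motion, on the time interval `I`, of two point particles of masses `m₁, m₂` in the field of
the centre, which interact with the potential energy `V(|x₁ - x₂|)`: a solution of Newton's
equations. The relative position stays where the potential energy is differentiable. -/
structure PotentialMotion (m₁ m₂ : ℝ) (V : ℝ → ℝ) (I : Set ℝ) (x₁ x₂ v₁ v₂ : ℝ → E3) : Prop where
  ordConnected : I.OrdConnected
  zero_mem : 0 ∈ I
  ne_zero : ∀ t ∈ I, x₁ t ≠ 0 ∧ x₂ t ≠ 0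
  velocity : ∀ t ∈ I, HasDerivWithinAt x₁ (v₁ t) I t ∧ HasDerivWithinAt x₂ (v₂ t) I t
  newton : ∀ t ∈ I, ∃ g : E3, HasGradientAt (fun z : E3 => V ‖z‖) g (x₁ t - x₂ t) ∧
    HasDerivWithinAt v₁ (gravity (x₁ t) - m₁⁻¹ • g) I t ∧
    HasDerivWithinAt v₂ (gravity (x₂ t) + m₂⁻¹ • g) I t

/-- Total energy of the two interacting point particles, divided by the total mass. -/
def interactingEnergy (m₁ m₂ : ℝ) (V : ℝ → ℝ) (x₁ x₂ v₁ v₂ : E3) : ℝ :=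
  meanEnergy (m₁ / (m₁ + m₂)) (m₂ / (m₁ + m₂)) (osculating x₁ v₁) (osculating x₂ v₂)
    + V ‖x₁ - x₂‖ / (m₁ + m₂)

end KeplerCollisions

end

/-!
Let two particles be at the same position, at distance `r` from the centre, and let `a`, `b` be
`|L₁| / √r`, `|L₂| / √r`. Then `r E₁ ≥ a² / 2 - 1`, `r E₂ ≥ b² / 2 - 1` and
`|L| ≤ √r (μ₁ a + μ₂ b)`. If the first orbit is not elliptic, either `E₁ ≥ 0` or `a = 0`. In the
first case the product of the mean energy and `|L|²` is least when `a = √2`, the body being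
parabolic with its pericentre there, and minimizing
`μ₂ (b² / 2 - 1) (μ₁ √2 + μ₂ b)²` over `b` gives `sigma μ₁ μ₂` (`sigma_le`); the second case
needs even more energy, and so does the escape of the heavy body (`sigma_le_swap`). Hence, below
the threshold, two particles at the same position are on elliptic orbits
(`elliptic_of_lt_sigma`). By compactness (`exists_uniform_bounds`) there are uniform bounds on the
eccentricities and the angular momenta for all states with particles close to each other, at
distance at least `ℓ² / 4` from the centre, and with a mean energy only slightly above `E`.

The mean angular momentum is conserved by all three dynamics. The mean energy does not increase in
collisions, and exceeds its initial value little in a weakly attractive potential. It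
remains to see that neither particle is close to the centre when they interact, and this
follows from the bounds themselves: if both energies are negative, then `|L_i|² ≤ 2 |x_i|`, so that
`ℓ² ≤ 2 max |x_i|` (`norm_lower_bound`). For hard spheres, the orbits are elliptic before a
collision, hence uniformly bounded after it, and they do not change until the next one: the proof
is an induction on the number of collisions (`HardSphereMotion.induction`). For a potential, the
set of times at which the bounds hold is closed; it is open because the orbits are locally constant
out of the range of the potential, and because within it the uniform bounds hold at nearby times.
-/

namespace KeplerCollisions

/-! ### The cross product -/

theorem cross_add_left (a b c : E3) : cross (a + b) c = cross a c + cross b c := by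
  simp [cross]

theorem cross_add_right (a b c : E3) : cross a (b + c) = cross a b + cross a c := by
  simp [cross]

theorem cross_smul_left (k : ℝ) (a b : E3) : cross (k • a) b = k • cross a b := by
  simp [cross]

theorem cross_smul_right (k : ℝ) (a b : E3) : cross a (k • b) = k • cross a b := by
  simp [cross]

theorem cross_self_eq_zero (a : E3) : cross a a = 0 := by
  simp [cross]

theorem cross_sub_left (a b c : E3) : cross (a - b) c = cross a c - cross b c := by
  simp [cross]

theorem cross_sub_right (a b c : E3) : cross a (b - c) = cross a b - cross a c := by
  simp [cross]

theorem norm_cross_le (a b : E3) : ‖cross a b‖ ≤ ‖a‖ * ‖b‖ := by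
  refine abs_le_of_sq_le_sq' ?_ (by positivity) |>.2
  rw [mul_pow, EuclideanSpace.norm_sq_eq, EuclideanSpace.norm_sq_eq, EuclideanSpace.norm_sq_eq]
  simp only [cross, cross_apply, Fin.sum_univ_three, Real.norm_eq_abs, sq_abs]
  simp
  nlinarith [sq_nonneg (a 0 * b 0 + a 1 * b 1 + a 2 * b 2)]

theorem isBoundedBilinearMap_cross :
    IsBoundedBilinearMap ℝ (fun p : E3 × E3 => cross p.1 p.2) where
  add_left := cross_add_left
  smul_left := cross_smul_left
  add_right := cross_add_right
  smul_right := cross_smul_right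
  bound := ⟨1, one_pos, fun a b => by simpa using norm_cross_le a b⟩

theorem continuous_cross : Continuous fun p : E3 × E3 => cross p.1 p.2 :=
  isBoundedBilinearMap_cross.continuous

/-! ### The threshold -/

theorem critEcc_spec {μ₁ μ₂ : ℝ} (h₁ : 0 < μ₁) (h₂ : 0 < μ₂) :
    0 < critEcc μ₁ μ₂ ∧ critEcc μ₁ μ₂ < 1 ∧
      2 * μ₂ ^ 2 * critEcc μ₁ μ₂ ^ 2 = μ₁ ^ 2 * (1 - critEcc μ₁ μ₂) := by
  have hk : 0 < (μ₁ / μ₂) ^ 2 := by positivity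
  have hk₂ : (μ₁ / μ₂) ^ 2 * μ₂ ^ 2 = μ₁ ^ 2 := by field_simp
  have hs : √((μ₁ / μ₂) ^ 4 + 8 * (μ₁ / μ₂) ^ 2) = 4 * critEcc μ₁ μ₂ + (μ₁ / μ₂) ^ 2 := by
    unfold critEcc; ring
  have hq : (4 * critEcc μ₁ μ₂ + (μ₁ / μ₂) ^ 2) ^ 2
      = ((μ₁ / μ₂) ^ 2) ^ 2 + 8 * (μ₁ / μ₂) ^ 2 := by
    rw [← hs, Real.sq_sqrt (by positivity)]; ring
  have hn : 0 ≤ 4 * critEcc μ₁ μ₂ + (μ₁ / μ₂) ^ 2 := hs ▸ Real.sqrt_nonneg _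
  generalize critEcc μ₁ μ₂ = e at *
  generalize (μ₁ / μ₂) ^ 2 = k at *
  have he : 0 < e := by
    by_contra! h
    nlinarith
  have hq' : 2 * e ^ 2 = k * (1 - e) := by nlinarith
  refine ⟨he, ?_, ?_⟩
  · by_contra! h
    nlinarith
  · rw [← hk₂]; linear_combination μ₂ ^ 2 * hq'

/-- The right-hand side is the product of the mean energy and the squared mean angular momentum,
when the first body is parabolic with its pericentre at distance `1`, and the second one has
angular momentum `b` and no radial velocity there. Its minimum, at
`b = √(1 - critEcc μ₁ μ₂)`, is `sigma μ₁ μ₂`. -/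
theorem sigma_le {μ₁ μ₂ : ℝ} (h₁ : 0 < μ₁) (h₂ : 0 < μ₂) {b : ℝ} (hb : 0 ≤ b) (hb' : b ≤ √2) :
    sigma μ₁ μ₂ ≤ -(μ₂ / 2 * (2 - b ^ 2) * (μ₁ * √2 + μ₂ * b) ^ 2) := by
  obtain ⟨he, he₁, hq⟩ := critEcc_spec h₁ h₂
  unfold sigma
  generalize critEcc μ₁ μ₂ = e at *
  have hs2 : √2 ^ 2 = (2 : ℝ) := Real.sq_sqrt (by norm_num)
  have hs0 : 0 < √(2 : ℝ) := by positivity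
  obtain ⟨c, hc0, hc⟩ : ∃ c : ℝ, 0 < c ∧ c ^ 2 = 1 - e :=
    ⟨√(1 - e), Real.sqrt_pos.2 (by linarith), Real.sq_sqrt (by linarith)⟩
  generalize √(2 : ℝ) = s at *
  -- `b = c` is the critical point of the right-hand side
  have hcrit : μ₁ * c = μ₂ * e * s := by
    have : (μ₁ * c) ^ 2 = (μ₂ * e * s) ^ 2 := by
      rw [mul_pow, mul_pow, hc, hs2]; linear_combination -hq
    exact (pow_left_inj₀ (by positivity) (by positivity) two_ne_zero).1 this
  have hval : (1 - e ^ 2) * (μ₁ ^ 2 + μ₂ ^ 2 * e) ^ 2 / (2 * μ₂ * e ^ 2)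
      = μ₂ / 2 * (2 - c ^ 2) * (μ₁ * s + μ₂ * c) ^ 2 := by
    have h3 : μ₁ * (μ₁ * s + μ₂ * c) = s * (μ₁ ^ 2 + μ₂ ^ 2 * e) := by
      linear_combination μ₂ * hcrit
    have h4 : μ₁ ^ 2 * (μ₁ * s + μ₂ * c) ^ 2 = 2 * (μ₁ ^ 2 + μ₂ ^ 2 * e) ^ 2 := by
      rw [← hs2, ← mul_pow, ← mul_pow, h3]
    rw [div_eq_iff (by positivity), hc]
    have h5 : (μ₁ * s + μ₂ * c) ^ 2 * (2 * μ₂ ^ 2 * e ^ 2)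
        = 2 * (1 - e) * (μ₁ ^ 2 + μ₂ ^ 2 * e) ^ 2 := by
      rw [hq]; linear_combination (1 - e) * h4
    linear_combination -(1 + e) / 2 * h5
  rw [hval, neg_le_neg_iff]
  have hc2 : c ^ 2 < 1 := by linarith
  have hbs : b ^ 2 ≤ 2 := by nlinarith
  have hbc : b * c ≤ 2 := by nlinarith [sq_nonneg (b - c)]
  -- the Cauchy-Schwarz inequality for `(b, √(2 - b²))` and `(c, √(2 - c²))`
  have hcs : (2 - b ^ 2) * (2 - c ^ 2) ≤ (2 - b * c) ^ 2 := by nlinarith [sq_nonneg (b - c)]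
  -- the maximum of a concave quadratic polynomial in `b`
  have hmax : (2 - b * c) * (μ₁ * s + μ₂ * b) ≤ (2 - c ^ 2) * (μ₁ * s + μ₂ * c) := by
    have : μ₁ * s * c = 2 * μ₂ * (1 - c ^ 2) := by
      rw [hc]; linear_combination s * hcrit + μ₂ * e * hs2
    have h6 : (2 - c ^ 2) * (μ₁ * s + μ₂ * c) - (2 - b * c) * (μ₁ * s + μ₂ * b)
        = μ₂ * c * (b - c) ^ 2 := by linear_combination (b - c) * this
    have : 0 ≤ μ₂ * c * (b - c) ^ 2 := by positivity
    linarith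
  have hA : 0 ≤ (2 - b * c) * (μ₁ * s + μ₂ * b) := mul_nonneg (by linarith) (by positivity)
  have hsq := pow_le_pow_left₀ hA hmax 2
  have h7 : (2 - c ^ 2) * ((2 - b ^ 2) * (μ₁ * s + μ₂ * b) ^ 2)
      ≤ (2 - c ^ 2) * ((2 - c ^ 2) * (μ₁ * s + μ₂ * c) ^ 2) := by
    calc _ = (2 - b ^ 2) * (2 - c ^ 2) * (μ₁ * s + μ₂ * b) ^ 2 := by ring
      _ ≤ (2 - b * c) ^ 2 * (μ₁ * s + μ₂ * b) ^ 2 := by gcongr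
      _ = ((2 - b * c) * (μ₁ * s + μ₂ * b)) ^ 2 := by ring
      _ ≤ _ := hsq
      _ = _ := by ring
  have h8 := le_of_mul_le_mul_left h7 (by linarith)
  nlinarith

/-- It takes more energy to let the heavy body escape than the light one. -/
theorem sigma_le_swap {μ₁ μ₂ : ℝ} (h₁ : 0 < μ₁) (h : μ₁ ≤ μ₂) {b : ℝ}
    (hb : 0 ≤ b) (hb' : b ≤ √2) :
    sigma μ₁ μ₂ ≤ -(μ₁ / 2 * (2 - b ^ 2) * (μ₂ * √2 + μ₁ * b) ^ 2) := by
  have h₂ : 0 < μ₂ := h₁.trans_le h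
  have hs2 : √2 ^ 2 = (2 : ℝ) := Real.sq_sqrt (by norm_num)
  have hs0 : 0 < √(2 : ℝ) := by positivity
  obtain ⟨y, hy⟩ : ∃ y, y = μ₁ * (√2 - b) / μ₂ := ⟨_, rfl⟩
  have hy' : μ₂ * y = μ₁ * (√2 - b) := by rw [hy]; field_simp
  have hy0 : 0 ≤ y := by rw [hy]; exact div_nonneg (mul_nonneg h₁.le (by linarith)) h₂.le
  have hy1 : y ≤ √2 - b := by
    rw [hy, div_le_iff₀ h₂, mul_comm]; exact mul_le_mul_of_nonneg_left h (by linarith)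
  -- the same mean angular momentum, with the roles of the bodies exchanged
  refine (sigma_le h₁ h₂ (b := √2 - y) (by linarith) (by linarith)).trans ?_
  have e1 : μ₁ * √2 + μ₂ * (√2 - y) = μ₂ * √2 + μ₁ * b := by linear_combination -hy'
  rw [e1, neg_le_neg_iff]
  refine mul_le_mul_of_nonneg_right ?_ (sq_nonneg _)
  have e2 : μ₂ / 2 * (2 - (√2 - y) ^ 2) = μ₁ / 2 * ((√2 - b) * (2 * √2 - y)) := by
    linear_combination (2 * √2 - y) / 2 * hy' - μ₂ / 2 * hs2
  rw [e2]
  have e3 : 2 - b ^ 2 ≤ (√2 - b) * (2 * √2 - y) := by nlinarith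
  exact mul_le_mul_of_nonneg_left e3 (by positivity)

theorem sigma_neg {μ₁ μ₂ : ℝ} (h₁ : 0 < μ₁) (h₂ : 0 < μ₂) : sigma μ₁ μ₂ < 0 := by
  refine (sigma_le h₁ h₂ le_rfl (Real.sqrt_nonneg _)).trans_lt ?_
  rw [neg_lt_zero]
  positivity

/-! ### Particles at the same position -/

/-- The inequality behind the stability of the first body, for particles at distance `1` from the
centre: `e₁, e₂` are energies and `a, b` norms of angular momenta. -/
theorem energy_neg_of_lt_of_unit {μ ν S : ℝ} (hμ : 0 < μ) (hν : 0 < ν) (hμν : μ + ν = 1)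
    (hS : ∀ b, 0 ≤ b → b ≤ √2 → S ≤ -(ν / 2 * (2 - b ^ 2) * (μ * √2 + ν * b) ^ 2))
    {a b e₁ e₂ : ℝ} (ha : 0 ≤ a) (hb : 0 ≤ b) (h₁ : a ^ 2 / 2 - 1 ≤ e₁) (h₂ : b ^ 2 / 2 - 1 ≤ e₂)
    (h : (μ * e₁ + ν * e₂) * (μ * a + ν * b) ^ 2 < S) : e₁ < 0 ∧ a ≠ 0 := by
  have hs2 : √2 ^ 2 = (2 : ℝ) := Real.sq_sqrt (by norm_num)
  have hs0 : 0 < √(2 : ℝ) := by positivity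
  have hs1 : 1 ≤ √(2 : ℝ) := by nlinarith
  have hSν : S ≤ -(ν / 2) := by
    have h3 := hS 1 zero_le_one hs1
    have h4 : 1 ≤ μ * √2 + ν * 1 := by nlinarith
    have h5 : 1 ≤ (μ * √2 + ν * 1) ^ 2 := one_le_pow₀ h4
    nlinarith
  constructor
  · by_contra! he
    have hX : μ * e₁ + ν * e₂ < 0 := by
      by_contra! hX
      have := mul_nonneg hX (sq_nonneg (μ * a + ν * b))
      linarith
    rcases le_total a (√2) with hab | hab
    · have hX' : ν * (b ^ 2 / 2 - 1) ≤ μ * e₁ + ν * e₂ := by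
        have := mul_nonneg hμ.le he
        have := mul_le_mul_of_nonneg_left h₂ hν.le
        linarith
      have hb2 : b ≤ √2 := by
        apply Real.le_sqrt_of_sq_le
        by_contra! hb2
        have : 0 < ν * (b ^ 2 / 2 - 1) := mul_pos hν (by linarith)
        linarith
      have h6 : (μ * a + ν * b) ^ 2 ≤ (μ * √2 + ν * b) ^ 2 := by gcongr
      have h7 := mul_le_mul_of_nonpos_left h6 hX.le
      have h8 := mul_le_mul_of_nonneg_right hX' (sq_nonneg (μ * √2 + ν * b))
      have := hS b hb hb2
      linarith
    · -- move the angular momenta towards each other, with the same mean, until the first is `√2`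
      obtain ⟨b', hb'⟩ : ∃ b', b' = b + μ * (a - √2) / ν := ⟨_, rfl⟩
      have hb'' : ν * (b' - b) = μ * (a - √2) := by rw [hb']; field_simp; ring
      have hbb : b ≤ b' := by
        rw [hb']
        have : 0 ≤ μ * (a - √2) / ν := div_nonneg (mul_nonneg hμ.le (by linarith)) hν.le
        linarith
      have hXab : μ * (a ^ 2 / 2 - 1) + ν * (b ^ 2 / 2 - 1) ≤ μ * e₁ + ν * e₂ := by gcongr
      have hsum : (μ * a + ν * b) ^ 2 ≤ μ * a ^ 2 + ν * b ^ 2 := by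
        have hν' : ν = 1 - μ := by linarith
        have h0 : 0 ≤ μ * ν * (a - b) ^ 2 := by positivity
        subst hν'
        nlinarith
      have hlt : μ * a + ν * b < √2 := by
        apply Real.lt_sqrt_of_sq_lt
        linarith
      have hb2 : b' ≤ √2 := by
        have : ν * b' < ν * √2 := by nlinarith
        exact (lt_of_mul_lt_mul_left this hν.le).le
      have hXb : ν * (b' ^ 2 / 2 - 1) ≤ μ * e₁ + ν * e₂ := by
        have h9 : ν * (b' ^ 2 - b ^ 2) ≤ μ * (a ^ 2 - 2) := by
          have e1 : ν * (b' ^ 2 - b ^ 2) = μ * (a - √2) * (b' + b) := by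
            linear_combination (b' + b) * hb''
          have e2 : μ * (a ^ 2 - 2) = μ * (a - √2) * (a + √2) := by
            linear_combination μ * hs2
          rw [e1, e2]
          exact mul_le_mul_of_nonneg_left (by linarith)
            (mul_nonneg hμ.le (by linarith))
        linarith
      have h8 := mul_le_mul_of_nonneg_right hXb (sq_nonneg (μ * √2 + ν * b'))
      have e3 : μ * a + ν * b = μ * √2 + ν * b' := by linear_combination -hb''
      rw [e3] at h
      have := hS b' (hb.trans hbb) hb2
      linarith
  · rintro rfl
    have h3 : -μ + ν * (b ^ 2 / 2 - 1) ≤ μ * e₁ + ν * e₂ := by nlinarith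
    have h4 := mul_le_mul_of_nonneg_right h3 (sq_nonneg (μ * 0 + ν * b))
    have h5 : (-μ + ν * (b ^ 2 / 2 - 1)) * (μ * 0 + ν * b) ^ 2 + ν / 2
        = ν / 2 * (ν * b ^ 2 - 1) ^ 2 := by
      have hμ' : μ = 1 - ν := by linarith
      subst hμ'; ring
    have : 0 ≤ ν / 2 * (ν * b ^ 2 - 1) ^ 2 := by positivity
    linarith

/-- The kinetic energy is at least that of the tangential motion; in units with `‖x‖ = 1`. -/
theorem energy_lower_bound {x v : E3} (hx : x ≠ 0) :
    (‖angMom x v‖ / √‖x‖) ^ 2 / 2 - 1 ≤ ‖x‖ * energy x v := by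
  have hr : 0 < ‖x‖ := norm_pos_iff.2 hx
  have h1 : ‖angMom x v‖ ^ 2 ≤ (‖x‖ * ‖v‖) ^ 2 := by
    have := norm_cross_le x v
    unfold angMom
    gcongr
  rw [div_pow, Real.sq_sqrt hr.le]
  have h2 : ‖angMom x v‖ ^ 2 / ‖x‖ ≤ ‖x‖ * ‖v‖ ^ 2 := by
    rw [div_le_iff₀ hr]; linarith
  have h3 : ‖x‖ * energy x v = ‖x‖ * ‖v‖ ^ 2 / 2 - 1 := by
    unfold energy; field_simp
  linarith

/-- The bound `S` stands for the threshold; the weights `μ`, `ν` are not ordered, so that either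
body can play the first role. -/
theorem elliptic_of_lt_of_bound {μ ν S : ℝ} (hμ : 0 < μ) (hν : 0 < ν) (hμν : μ + ν = 1)
    (hS : ∀ b, 0 ≤ b → b ≤ √2 → S ≤ -(ν / 2 * (2 - b ^ 2) * (μ * √2 + ν * b) ^ 2))
    {x v₁ v₂ : E3} (hx : x ≠ 0)
    (h : (μ * energy x v₁ + ν * energy x v₂) * ‖μ • angMom x v₁ + ν • angMom x v₂‖ ^ 2 < S) :
    (osculating x v₁).IsElliptic := by
  have hr : 0 < ‖x‖ := norm_pos_iff.2 hx
  have hsr : 0 < √‖x‖ := Real.sqrt_pos.2 hr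
  have hS0 : S ≤ 0 := by
    simpa [Real.sq_sqrt] using hS (√2) (Real.sqrt_nonneg _) le_rfl
  have hn : ‖μ • angMom x v₁ + ν • angMom x v₂‖ ≤ μ * ‖angMom x v₁‖ + ν * ‖angMom x v₂‖ := by
    refine (norm_add_le _ _).trans_eq ?_
    rw [norm_smul, norm_smul, Real.norm_of_nonneg hμ.le, Real.norm_of_nonneg hν.le]
  have hX : μ * energy x v₁ + ν * energy x v₂ < 0 := by
    by_contra! hX
    have := mul_nonneg hX (sq_nonneg ‖μ • angMom x v₁ + ν • angMom x v₂‖)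
    linarith
  have hsc : (μ * (‖x‖ * energy x v₁) + ν * (‖x‖ * energy x v₂))
      * (μ * (‖angMom x v₁‖ / √‖x‖) + ν * (‖angMom x v₂‖ / √‖x‖)) ^ 2 < S := by
    have e1 : μ * (‖angMom x v₁‖ / √‖x‖) + ν * (‖angMom x v₂‖ / √‖x‖)
        = (μ * ‖angMom x v₁‖ + ν * ‖angMom x v₂‖) / √‖x‖ := by ring
    rw [e1, div_pow, Real.sq_sqrt hr.le]
    have e2 : (μ * (‖x‖ * energy x v₁) + ν * (‖x‖ * energy x v₂))
        * ((μ * ‖angMom x v₁‖ + ν * ‖angMom x v₂‖) ^ 2 / ‖x‖)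
        = (μ * energy x v₁ + ν * energy x v₂) * (μ * ‖angMom x v₁‖ + ν * ‖angMom x v₂‖) ^ 2 := by
      field_simp
    rw [e2]
    refine lt_of_le_of_lt ?_ h
    exact mul_le_mul_of_nonpos_left (by gcongr) hX.le
  obtain ⟨h1, h2⟩ := energy_neg_of_lt_of_unit hμ hν hμν hS (by positivity) (by positivity)
    (energy_lower_bound hx) (energy_lower_bound hx) hsc
  refine ⟨by simpa [osculating] using neg_of_mul_neg_right h1 hr.le, fun h0 => h2 ?_⟩
  have h0' : angMom x v₁ = 0 := h0
  simp [h0']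

/-- Below the threshold, two particles at the same position are on elliptic orbits. -/
theorem elliptic_of_lt_sigma {μ₁ μ₂ : ℝ} (h₁ : 0 < μ₁) (h : μ₁ ≤ μ₂) (h12 : μ₁ + μ₂ = 1)
    {x v₁ v₂ : E3} (hx : x ≠ 0)
    (hσ : meanEnergy μ₁ μ₂ (osculating x v₁) (osculating x v₂)
      * ‖meanAngMom μ₁ μ₂ (osculating x v₁) (osculating x v₂)‖ ^ 2 < sigma μ₁ μ₂) :
    (osculating x v₁).IsElliptic ∧ (osculating x v₂).IsElliptic := by
  have h₂ : 0 < μ₂ := h₁.trans_le h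
  refine ⟨elliptic_of_lt_of_bound h₁ h₂ h12 (fun b hb hb' => sigma_le h₁ h₂ hb hb') hx hσ,
    elliptic_of_lt_of_bound h₂ h₁ (by linarith) (fun b hb hb' => sigma_le_swap h₁ h hb hb')
      (v₁ := v₂) (v₂ := v₁) hx ?_⟩
  rw [add_comm, add_comm (μ₂ • _)]
  exact hσ

/-! ### Distances to the centre -/

theorem norm_angMom_sq_le {x v : E3} (hx : x ≠ 0) (h : energy x v ≤ 0) :
    ‖angMom x v‖ ^ 2 ≤ 2 * ‖x‖ := by
  have hr : 0 < ‖x‖ := norm_pos_iff.2 hx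
  have h1 := energy_lower_bound (v := v) hx
  have h2 := mul_nonpos_of_nonneg_of_nonpos hr.le h
  rw [div_pow, Real.sq_sqrt hr.le] at h1
  have h3 : ‖angMom x v‖ ^ 2 / ‖x‖ ≤ 2 := by linarith
  rwa [div_le_iff₀ hr] at h3

/-- Two bodies which are close to each other and have negative energies are not close to the
centre. -/
theorem norm_lower_bound {μ₁ μ₂ D : ℝ} (h₁ : 0 < μ₁) (h₂ : 0 < μ₂) (h12 : μ₁ + μ₂ = 1)
    {x₁ x₂ v₁ v₂ : E3} (hx₁ : x₁ ≠ 0) (hx₂ : x₂ ≠ 0) (hD : ‖x₁ - x₂‖ ≤ D)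
    (hE₁ : energy x₁ v₁ ≤ 0) (hE₂ : energy x₂ v₂ ≤ 0) :
    ‖meanAngMom μ₁ μ₂ (osculating x₁ v₁) (osculating x₂ v₂)‖ ^ 2 / 2 - D ≤ ‖x₁‖ ∧
    ‖meanAngMom μ₁ μ₂ (osculating x₁ v₁) (osculating x₂ v₂)‖ ^ 2 / 2 - D ≤ ‖x₂‖ := by
  have ha := norm_angMom_sq_le hx₁ hE₁
  have hb := norm_angMom_sq_le hx₂ hE₂
  have hn : ‖meanAngMom μ₁ μ₂ (osculating x₁ v₁) (osculating x₂ v₂)‖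
      ≤ μ₁ * ‖angMom x₁ v₁‖ + μ₂ * ‖angMom x₂ v₂‖ := by
    refine (norm_add_le _ _).trans_eq ?_
    rw [norm_smul, norm_smul, Real.norm_of_nonneg h₁.le, Real.norm_of_nonneg h₂.le]
    rfl
  have hsq : ‖meanAngMom μ₁ μ₂ (osculating x₁ v₁) (osculating x₂ v₂)‖ ^ 2
      ≤ μ₁ * ‖angMom x₁ v₁‖ ^ 2 + μ₂ * ‖angMom x₂ v₂‖ ^ 2 := by
    refine (pow_le_pow_left₀ (norm_nonneg _) hn 2).trans ?_
    have h0 : 0 ≤ μ₁ * μ₂ * (‖angMom x₁ v₁‖ - ‖angMom x₂ v₂‖) ^ 2 := by positivity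
    have : μ₂ = 1 - μ₁ := by linarith
    subst this
    nlinarith
  have hd1 := norm_sub_norm_le x₁ x₂
  have hd2 := norm_sub_norm_le x₂ x₁
  rw [norm_sub_rev] at hd2
  have hm₂ : μ₁ * (2 * ‖x₁‖) ≤ μ₁ * (2 * (‖x₂‖ + D)) := by
    gcongr; linarith
  have hm₁ : μ₂ * (2 * ‖x₂‖) ≤ μ₂ * (2 * (‖x₁‖ + D)) := by
    gcongr; linarith
  have hD0 : 0 ≤ D := (norm_nonneg _).trans hD
  have p1 := mul_le_mul_of_nonneg_left ha h₁.le
  have p2 := mul_le_mul_of_nonneg_left hb h₂.le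
  have q1 := mul_nonneg h₁.le hD0
  have q2 := mul_nonneg h₂.le hD0
  have e1 : μ₂ = 1 - μ₁ := by linarith
  subst e1
  constructor <;> nlinarith

/-! ### Uniform bounds for particles close to each other -/

/-- The orbit is an ellipse, with eccentricity at most `c` and angular momentum at most `B`. -/
def Orbit.BoundedBy (c B : ℝ) (o : Orbit) : Prop := o.IsElliptic ∧ o.ecc ≤ c ∧ ‖o.angMom‖ ≤ B

theorem Orbit.BoundedBy.mono {c c' B B' : ℝ} {o : Orbit} (h : o.BoundedBy c B) (hc : c ≤ c')
    (hB : B ≤ B') : o.BoundedBy c' B' :=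
  ⟨h.1, h.2.1.trans hc, h.2.2.trans hB⟩

theorem Orbit.IsElliptic.of_mul_neg {o : Orbit} (h : o.energy * ‖o.angMom‖ ^ 2 < 0) :
    o.IsElliptic := by
  constructor
  · by_contra! h0
    exact absurd h (mul_nonneg h0 (sq_nonneg _)).not_gt
  · intro h0
    simp [h0] at h

theorem Orbit.BoundedBy.of_mul_le {o : Orbit} {δ B : ℝ} (hδ : 0 < δ)
    (h : o.energy * ‖o.angMom‖ ^ 2 ≤ -δ) (hB : ‖o.angMom‖ ≤ B) :
    o.BoundedBy (√(1 - 2 * δ)) B :=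
  ⟨.of_mul_neg (h.trans_lt (by linarith)), Real.sqrt_le_sqrt (by linarith), hB⟩

theorem continuousOn_energy : ContinuousOn (fun p : E3 × E3 => energy p.1 p.2) {p | p.1 ≠ 0} := by
  unfold energy
  refine ContinuousOn.sub (by fun_prop) (ContinuousOn.div (by fun_prop) (by fun_prop) ?_)
  intro p hp
  simpa using hp

theorem continuous_angMom : Continuous (fun p : E3 × E3 => angMom p.1 p.2) := continuous_cross

/-- A bound for the positions and the velocities, in terms of a negative upper bound `E` for the
mean energy. -/
theorem norm_le_of_meanEnergy_le {μ₁ μ₂ E ρ : ℝ} (h₁ : 0 < μ₁) (h₂ : 0 < μ₂) (h12 : μ₁ + μ₂ = 1)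
    (hE : E < 0) (hρ : 0 < ρ) {x₁ x₂ v₁ v₂ : E3} (hx₁ : ρ ≤ ‖x₁‖) (hx₂ : ρ ≤ ‖x₂‖)
    (hD : ‖x₁ - x₂‖ ≤ 1) (h : meanEnergy μ₁ μ₂ (osculating x₁ v₁) (osculating x₂ v₂) ≤ E) :
    ‖x₁‖ ≤ 1 / -E + 1 ∧ ‖x₂‖ ≤ 1 / -E + 1 ∧
      μ₁ * ‖v₁‖ ^ 2 ≤ 2 / ρ ∧ μ₂ * ‖v₂‖ ^ 2 ≤ 2 / ρ := by
  have h' : μ₁ * (‖v₁‖ ^ 2 / 2 - 1 / ‖x₁‖) + μ₂ * (‖v₂‖ ^ 2 / 2 - 1 / ‖x₂‖) ≤ E := h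
  have hv₁ : 0 ≤ μ₁ * ‖v₁‖ ^ 2 := by positivity
  have hv₂ : 0 ≤ μ₂ * ‖v₂‖ ^ 2 := by positivity
  have hd1 := norm_sub_norm_le x₁ x₂
  have hd2 := norm_sub_norm_le x₂ x₁
  rw [norm_sub_rev] at hd2
  have key : ‖x₁‖ ≤ 1 / -E ∨ ‖x₂‖ ≤ 1 / -E := by
    by_contra! hc
    have a1 : 1 / ‖x₁‖ < -E := by
      rw [div_lt_iff₀ (by linarith)]
      have := (div_lt_iff₀ (by linarith)).1 hc.1
      linarith
    have a2 : 1 / ‖x₂‖ < -E := by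
      rw [div_lt_iff₀ (by linarith)]
      have := (div_lt_iff₀ (by linarith)).1 hc.2
      linarith
    have b1 := mul_lt_mul_of_pos_left a1 h₁
    have b2 := mul_lt_mul_of_pos_left a2 h₂
    have : μ₂ = 1 - μ₁ := by linarith
    subst this
    linarith
  have c1 : 1 / ‖x₁‖ ≤ 1 / ρ := one_div_le_one_div_of_le hρ hx₁
  have c2 : 1 / ‖x₂‖ ≤ 1 / ρ := one_div_le_one_div_of_le hρ hx₂
  have d1 := mul_le_mul_of_nonneg_left c1 h₁.le
  have d2 := mul_le_mul_of_nonneg_left c2 h₂.le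
  have hsum : μ₁ * (1 / ρ) + μ₂ * (1 / ρ) = 1 / ρ := by rw [← add_mul, h12, one_mul]
  have e2 : 2 / ρ = 2 * (1 / ρ) := by ring
  refine ⟨?_, ?_, by linarith, by linarith⟩
  · rcases key with hk | hk <;> linarith
  · rcases key with hk | hk <;> linarith

theorem exists_forall_le_of_isCompact {α : Type*} [TopologicalSpace α] {K : Set α}
    (hK : IsCompact K) {f : α → ℝ} (hf : ContinuousOn f K) : ∃ B, ∀ p ∈ K, f p ≤ B := by
  obtain ⟨B, hB⟩ := (hK.image_of_continuousOn hf).bddAbove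
  exact ⟨B, fun p hp => hB ⟨p, hp, rfl⟩⟩

/-- If a continuous function is negative at the points of a compact set where `g ≤ 0`, it is
uniformly negative at those where `g ≤ d`, for a small `d > 0`. -/
theorem exists_forall_le_neg_of_isCompact {α : Type*} [TopologicalSpace α]
    {K : Set α} (hK : IsCompact K) {f g : α → ℝ} (hf : ContinuousOn f K) (hg : ContinuousOn g K)
    (h : ∀ p ∈ K, g p ≤ 0 → f p < 0) :
    ∃ d > 0, ∃ δ > 0, ∀ p ∈ K, g p ≤ d → f p ≤ -δ := by
  have hneg : ContinuousOn (fun p => -f p ⊔ g p) K := by fun_prop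
  rcases K.eq_empty_or_nonempty with rfl | hne
  · exact ⟨1, one_pos, 1, one_pos, by simp⟩
  obtain ⟨p₀, hp₀, hmin⟩ := hK.exists_isMinOn hne hneg
  have hpos : 0 < -f p₀ ⊔ g p₀ := by
    by_cases h0 : g p₀ ≤ 0
    · exact lt_sup_of_lt_left (by linarith [h p₀ hp₀ h0])
    · exact lt_sup_of_lt_right (not_le.1 h0)
  set m := -f p₀ ⊔ g p₀
  refine ⟨m / 2, by linarith, m, hpos, fun p hp hgp => ?_⟩
  have h1 : m ≤ -f p ⊔ g p := hmin hp
  rcases le_sup_iff.1 h1 with h2 | h2 <;> linarith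

/-- The states `(x₁, x₂, v₁, v₂)` in the ball of radius `M`, away from the centre, and with
mean angular momentum `ℓ`. -/
def boundedStates (μ₁ μ₂ ρ M ℓ : ℝ) : Set (E3 × E3 × E3 × E3) :=
  {p | p ∈ Metric.closedBall 0 M ∧ (ρ ≤ ‖p.1‖ ∧ ρ ≤ ‖p.2.1‖) ∧
    ‖μ₁ • angMom p.1 p.2.2.1 + μ₂ • angMom p.2.1 p.2.2.2‖ = ℓ}

theorem ne_zero_of_mem_boundedStates {μ₁ μ₂ ρ M ℓ : ℝ} (hρ : 0 < ρ) {p : E3 × E3 × E3 × E3}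
    (hp : p ∈ boundedStates μ₁ μ₂ ρ M ℓ) : p.1 ≠ 0 ∧ p.2.1 ≠ 0 := by
  obtain ⟨-, ⟨h₁, h₂⟩, -⟩ := hp
  exact ⟨norm_pos_iff.1 (hρ.trans_le h₁), norm_pos_iff.1 (hρ.trans_le h₂)⟩

theorem continuous_angMom_fst : Continuous fun p : E3 × E3 × E3 × E3 => angMom p.1 p.2.2.1 :=
  continuous_angMom.comp (continuous_fst.prodMk continuous_snd.snd.fst)

theorem continuous_angMom_snd : Continuous fun p : E3 × E3 × E3 × E3 => angMom p.2.1 p.2.2.2 :=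
  continuous_angMom.comp (continuous_snd.fst.prodMk continuous_snd.snd.snd)

theorem continuousOn_energy_fst {μ₁ μ₂ ρ M ℓ : ℝ} (hρ : 0 < ρ) :
    ContinuousOn (fun p : E3 × E3 × E3 × E3 => energy p.1 p.2.2.1)
      (boundedStates μ₁ μ₂ ρ M ℓ) := by
  have h : Continuous fun p : E3 × E3 × E3 × E3 => (p.1, p.2.2.1) :=
    continuous_fst.prodMk continuous_snd.snd.fst
  refine continuousOn_energy.comp (f := fun p : E3 × E3 × E3 × E3 => (p.1, p.2.2.1)) h.continuousOn ?_
  intro p hp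
  exact (ne_zero_of_mem_boundedStates hρ hp).1

theorem continuousOn_energy_snd {μ₁ μ₂ ρ M ℓ : ℝ} (hρ : 0 < ρ) :
    ContinuousOn (fun p : E3 × E3 × E3 × E3 => energy p.2.1 p.2.2.2)
      (boundedStates μ₁ μ₂ ρ M ℓ) := by
  have h : Continuous fun p : E3 × E3 × E3 × E3 => (p.2.1, p.2.2.2) :=
    continuous_snd.fst.prodMk continuous_snd.snd.snd
  refine continuousOn_energy.comp (f := fun p : E3 × E3 × E3 × E3 => (p.2.1, p.2.2.2)) h.continuousOn ?_
  intro p hp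
  exact (ne_zero_of_mem_boundedStates hρ hp).2

theorem isCompact_boundedStates (μ₁ μ₂ ρ M ℓ : ℝ) :
    IsCompact (boundedStates μ₁ μ₂ ρ M ℓ) := by
  refine (isCompact_closedBall _ _).inter_right (((isClosed_le continuous_const
    continuous_fst.norm).inter (isClosed_le continuous_const continuous_snd.fst.norm)).inter
    (isClosed_eq ?_ continuous_const))
  exact ((continuous_angMom_fst.const_smul μ₁).add (continuous_angMom_snd.const_smul μ₂)).norm

theorem Orbit.IsElliptic.mul_neg {o : Orbit} (h : o.IsElliptic) :
    o.energy * ‖o.angMom‖ ^ 2 < 0 :=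
  mul_neg_of_neg_of_pos h.1 (by have := norm_pos_iff.2 h.2; positivity)

theorem exists_uniform_bounds_of_mem_boundedStates {μ₁ μ₂ E ℓ ρ : ℝ} (M : ℝ) (h₁ : 0 < μ₁)
    (h : μ₁ ≤ μ₂) (h12 : μ₁ + μ₂ = 1) (hρ : 0 < ρ) (hσ : E * ℓ ^ 2 < sigma μ₁ μ₂) :
    ∃ d c B : ℝ, 0 < d ∧ c < 1 ∧ ∀ p ∈ boundedStates μ₁ μ₂ ρ M ℓ, ‖p.1 - p.2.1‖ ≤ d →
      meanEnergy μ₁ μ₂ (osculating p.1 p.2.2.1) (osculating p.2.1 p.2.2.2) ≤ E + d →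
      (osculating p.1 p.2.2.1).BoundedBy c B ∧ (osculating p.2.1 p.2.2.2).BoundedBy c B := by
  have hK := isCompact_boundedStates μ₁ μ₂ ρ M ℓ
  have he₁ := continuousOn_energy_fst (μ₁ := μ₁) (μ₂ := μ₂) (M := M) (ℓ := ℓ) hρ
  have he₂ := continuousOn_energy_snd (μ₁ := μ₁) (μ₂ := μ₂) (M := M) (ℓ := ℓ) hρ
  have hl₁ := continuous_angMom_fst
  have hl₂ := continuous_angMom_snd
  have hd : Continuous fun p : E3 × E3 × E3 × E3 => ‖p.1 - p.2.1‖ :=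
    (continuous_fst.sub continuous_snd.fst).norm
  have hg : ContinuousOn (fun p : E3 × E3 × E3 × E3 => ‖p.1 - p.2.1‖
      ⊔ (meanEnergy μ₁ μ₂ (osculating p.1 p.2.2.1) (osculating p.2.1 p.2.2.2) - E))
      (boundedStates μ₁ μ₂ ρ M ℓ) :=
    hd.continuousOn.sup
      (((continuousOn_const.mul he₁).add (continuousOn_const.mul he₂)).sub continuousOn_const)
  have hstat : ∀ p ∈ boundedStates μ₁ μ₂ ρ M ℓ, ‖p.1 - p.2.1‖
      ⊔ (meanEnergy μ₁ μ₂ (osculating p.1 p.2.2.1) (osculating p.2.1 p.2.2.2) - E) ≤ 0 →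
      (osculating p.1 p.2.2.1).IsElliptic ∧ (osculating p.2.1 p.2.2.2).IsElliptic := by
    rintro ⟨x₁, x₂, v₁, v₂⟩ hp hgp
    obtain ⟨hg1, hg2⟩ := sup_le_iff.1 hgp
    have hx : x₁ = x₂ := sub_eq_zero.1 (norm_le_zero_iff.1 hg1)
    subst hx
    refine elliptic_of_lt_sigma h₁ h h12 (ne_zero_of_mem_boundedStates hρ hp).1 ?_
    have hL : ‖meanAngMom μ₁ μ₂ (osculating x₁ v₁) (osculating x₁ v₂)‖ = ℓ := hp.2.2
    rw [hL]
    exact (mul_le_mul_of_nonneg_right (sub_nonpos.1 hg2) (sq_nonneg ℓ)).trans_lt hσ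
  obtain ⟨d₁, hd₁, δ₁, hδ₁, H₁⟩ := exists_forall_le_neg_of_isCompact hK
    (f := fun p : E3 × E3 × E3 × E3 => energy p.1 p.2.2.1 * ‖angMom p.1 p.2.2.1‖ ^ 2)
    (he₁.mul (hl₁.norm.pow 2).continuousOn) hg (fun p hp hgp => (hstat p hp hgp).1.mul_neg)
  obtain ⟨d₂, hd₂, δ₂, hδ₂, H₂⟩ := exists_forall_le_neg_of_isCompact hK
    (f := fun p : E3 × E3 × E3 × E3 => energy p.2.1 p.2.2.2 * ‖angMom p.2.1 p.2.2.2‖ ^ 2)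
    (he₂.mul (hl₂.norm.pow 2).continuousOn) hg (fun p hp hgp => (hstat p hp hgp).2.mul_neg)
  obtain ⟨B₁, hB₁⟩ := exists_forall_le_of_isCompact hK hl₁.norm.continuousOn
  obtain ⟨B₂, hB₂⟩ := exists_forall_le_of_isCompact hK hl₂.norm.continuousOn
  have hc : ∀ δ : ℝ, 0 < δ → √(1 - 2 * δ) < 1 := fun δ hδ => by
    rw [Real.sqrt_lt' one_pos]; linarith
  refine ⟨min d₁ d₂, √(1 - 2 * δ₁) ⊔ √(1 - 2 * δ₂), B₁ ⊔ B₂, lt_min hd₁ hd₂,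
    sup_lt_iff.2 ⟨hc _ hδ₁, hc _ hδ₂⟩, fun p hp hD hE => ?_⟩
  have hg' : ‖p.1 - p.2.1‖
      ⊔ (meanEnergy μ₁ μ₂ (osculating p.1 p.2.2.1) (osculating p.2.1 p.2.2.2) - E)
      ≤ min d₁ d₂ := sup_le hD (sub_le_iff_le_add'.2 hE)
  have b₁ : (osculating p.1 p.2.2.1).BoundedBy (√(1 - 2 * δ₁)) B₁ :=
    .of_mul_le hδ₁ (H₁ p hp (hg'.trans (min_le_left _ _))) (hB₁ p hp)
  have b₂ : (osculating p.2.1 p.2.2.2).BoundedBy (√(1 - 2 * δ₂)) B₂ :=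
    .of_mul_le hδ₂ (H₂ p hp (hg'.trans (min_le_right _ _))) (hB₂ p hp)
  exact ⟨b₁.mono le_sup_left le_sup_left, b₂.mono le_sup_right le_sup_right⟩

theorem neg_and_sq_pos_of_lt_sigma {μ₁ μ₂ E ℓ : ℝ} (h₁ : 0 < μ₁) (h₂ : 0 < μ₂)
    (hσ : E * ℓ ^ 2 < sigma μ₁ μ₂) : E < 0 ∧ 0 < ℓ ^ 2 := by
  have hσ0 := sigma_neg h₁ h₂
  constructor
  · by_contra! hE
    have := mul_nonneg hE (sq_nonneg ℓ)
    linarith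
  · refine lt_of_le_of_ne (sq_nonneg ℓ) fun h0 => ?_
    rw [← h0] at hσ
    linarith

/-- Uniform bounds, for particles close to each other and away from the centre, with a mean
energy not much larger than `E` and a mean angular momentum `ℓ`. They follow from the case of
particles at the same position by compactness. -/
theorem exists_uniform_bounds {μ₁ μ₂ E ℓ : ℝ} (h₁ : 0 < μ₁) (h : μ₁ ≤ μ₂) (h12 : μ₁ + μ₂ = 1)
    (hσ : E * ℓ ^ 2 < sigma μ₁ μ₂) :
    ∃ d c B : ℝ, 0 < d ∧ c < 1 ∧ ∀ x₁ x₂ v₁ v₂ : E3,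
      ℓ ^ 2 / 4 ≤ ‖x₁‖ → ℓ ^ 2 / 4 ≤ ‖x₂‖ → ‖x₁ - x₂‖ ≤ d →
      meanEnergy μ₁ μ₂ (osculating x₁ v₁) (osculating x₂ v₂) ≤ E + d →
      ‖meanAngMom μ₁ μ₂ (osculating x₁ v₁) (osculating x₂ v₂)‖ = ℓ →
      (osculating x₁ v₁).BoundedBy c B ∧ (osculating x₂ v₂).BoundedBy c B := by
  have h₂ : 0 < μ₂ := h₁.trans_le h
  obtain ⟨hE, hℓ⟩ := neg_and_sq_pos_of_lt_sigma h₁ h₂ hσ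
  obtain ⟨ρ, hρ⟩ : ∃ ρ, ρ = ℓ ^ 2 / 4 := ⟨_, rfl⟩
  rw [← hρ]
  have hρ0 : 0 < ρ := by rw [hρ]; positivity
  obtain ⟨d, c, B, hd, hc, H⟩ := exists_uniform_bounds_of_mem_boundedStates
    ((1 / -(E / 2) + 1) ⊔ √(2 / ρ / μ₁) ⊔ √(2 / ρ / μ₂)) h₁ h h12 hρ0 hσ
  refine ⟨min (min 1 (-(E / 2))) d, c, B, lt_min (lt_min one_pos (by linarith)) hd, hc, ?_⟩
  intro x₁ x₂ v₁ v₂ hx₁ hx₂ hD hEd hL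
  have m1 : min (min 1 (-(E / 2))) d ≤ 1 := (min_le_left _ _).trans (min_le_left _ _)
  have m2 : min (min 1 (-(E / 2))) d ≤ -(E / 2) := (min_le_left _ _).trans (min_le_right _ _)
  have m3 : min (min 1 (-(E / 2))) d ≤ d := min_le_right _ _
  obtain ⟨b1, b2, b3, b4⟩ := norm_le_of_meanEnergy_le h₁ h₂ h12 (E := E / 2) (by linarith) hρ0
    hx₁ hx₂ (v₁ := v₁) (v₂ := v₂) (hD.trans m1) (by linarith)
  have b3' : ‖v₁‖ ≤ √(2 / ρ / μ₁) :=
    Real.le_sqrt_of_sq_le (by rw [le_div_iff₀ h₁]; linarith)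
  have b4' : ‖v₂‖ ≤ √(2 / ρ / μ₂) :=
    Real.le_sqrt_of_sq_le (by rw [le_div_iff₀ h₂]; linarith)
  refine H (x₁, x₂, v₁, v₂) ⟨?_, ⟨hx₁, hx₂⟩, hL⟩ (hD.trans m3) (hEd.trans (by linarith))
  rw [mem_closedBall_zero_iff]
  simp only [Prod.norm_mk, sup_le_iff]
  exact ⟨b1.trans (le_sup_of_le_left le_sup_left), b2.trans (le_sup_of_le_left le_sup_left),
    b3'.trans (le_sup_of_le_left le_sup_right), b4'.trans le_sup_right⟩

/-! ### Collisions -/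

/-- The decomposition of the kinetic energy into those of the centre of mass and of the relative
motion. -/
theorem mean_norm_sq {μ₁ μ₂ : ℝ} (h12 : μ₁ + μ₂ = 1) (a b : E3) :
    μ₁ * ‖a‖ ^ 2 + μ₂ * ‖b‖ ^ 2 = ‖μ₁ • a + μ₂ • b‖ ^ 2 + μ₁ * μ₂ * ‖a - b‖ ^ 2 := by
  rw [norm_add_sq_real, norm_sub_sq_real, norm_smul, norm_smul, mul_pow, mul_pow,
    Real.norm_eq_abs, Real.norm_eq_abs, sq_abs, sq_abs, real_inner_smul_left,
    real_inner_smul_right]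
  have : μ₂ = 1 - μ₁ := by linarith
  subst this
  ring

theorem ImpactRule.norm_sub_sq_le {μ₁ μ₂ ε : ℝ} {n u₁ u₂ v₁ v₂ : E3}
    (h : ImpactRule μ₁ μ₂ n ε u₁ u₂ v₁ v₂) (hn : ‖n‖ = 1) (hε : 0 ≤ ε) (hε' : ε ≤ 1 / 2) :
    ‖v₁ - v₂‖ ^ 2 ≤ ‖u₁ - u₂‖ ^ 2 := by
  have e : v₁ - v₂ = (u₁ - u₂) - ((2 - 2 * ε) * ⟪n, u₁ - u₂⟫) • n := by
    rw [h.1]; module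
  rw [e, norm_sub_sq_real, norm_smul, hn, real_inner_smul_right, real_inner_comm,
    Real.norm_eq_abs, mul_one, sq_abs]
  have : 0 ≤ (2 - 2 * ε) * (2 * ε) * ⟪n, u₁ - u₂⟫ ^ 2 :=
    mul_nonneg (mul_nonneg (by linarith) (by linarith)) (sq_nonneg _)
  nlinarith

theorem ImpactRule.meanEnergy_le {μ₁ μ₂ ε : ℝ} (h₁ : 0 < μ₁) (h₂ : 0 < μ₂) (h12 : μ₁ + μ₂ = 1)
    {n u₁ u₂ v₁ v₂ : E3} (h : ImpactRule μ₁ μ₂ n ε u₁ u₂ v₁ v₂) (hn : ‖n‖ = 1) (hε : 0 ≤ ε)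
    (hε' : ε ≤ 1 / 2) (x₁ x₂ : E3) :
    meanEnergy μ₁ μ₂ (osculating x₁ v₁) (osculating x₂ v₂)
      ≤ meanEnergy μ₁ μ₂ (osculating x₁ u₁) (osculating x₂ u₂) := by
  have hu := mean_norm_sq h12 u₁ u₂
  have hv := mean_norm_sq h12 v₁ v₂
  rw [h.2] at hv
  have := mul_le_mul_of_nonneg_left (h.norm_sub_sq_le hn hε hε') (mul_pos h₁ h₂).le
  simp only [meanEnergy, osculating, energy]
  linarith

theorem meanAngMom_osculating {μ₁ μ₂ : ℝ} (h12 : μ₁ + μ₂ = 1) (x₁ x₂ v₁ v₂ : E3) :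
    meanAngMom μ₁ μ₂ (osculating x₁ v₁) (osculating x₂ v₂)
      = cross (μ₁ • x₁ + μ₂ • x₂) (μ₁ • v₁ + μ₂ • v₂) + (μ₁ * μ₂) • cross (x₁ - x₂) (v₁ - v₂) := by
  simp only [meanAngMom, osculating, angMom, cross_add_left, cross_add_right, cross_sub_left,
    cross_sub_right, cross_smul_left, cross_smul_right]
  have : μ₂ = 1 - μ₁ := by linarith
  subst this
  module

theorem ImpactRule.meanAngMom_eq {μ₁ μ₂ ε : ℝ} (h12 : μ₁ + μ₂ = 1) {n u₁ u₂ v₁ v₂ x₁ x₂ : E3}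
    (h : ImpactRule μ₁ μ₂ n ε u₁ u₂ v₁ v₂) (hx : cross (x₁ - x₂) n = 0) :
    meanAngMom μ₁ μ₂ (osculating x₁ v₁) (osculating x₂ v₂)
      = meanAngMom μ₁ μ₂ (osculating x₁ u₁) (osculating x₂ u₂) := by
  rw [meanAngMom_osculating h12, meanAngMom_osculating h12, h.2, h.1]
  congr 2
  rw [cross_sub_right _ _ ((_ : ℝ) • n), cross_sub_right _ _ ((_ : ℝ) • n), cross_smul_right,
    cross_smul_right, hx]
  simp

/-! ### The dynamics of the orbits -/

theorem OrbitStep.invariants {μ₁ μ₂ : ℝ} (h₁ : 0 < μ₁) (h₂ : 0 < μ₂) (h12 : μ₁ + μ₂ = 1)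
    {o o' : Orbit × Orbit} (h : OrbitStep μ₁ μ₂ o o') :
    Intersect o'.1 o'.2 ∧ meanEnergy μ₁ μ₂ o'.1 o'.2 ≤ meanEnergy μ₁ μ₂ o.1 o.2 ∧
      meanAngMom μ₁ μ₂ o'.1 o'.2 = meanAngMom μ₁ μ₂ o.1 o.2 := by
  obtain ⟨p, u₁, u₂, v₁, v₂, n, ε, ⟨hp, ho₁⟩, ⟨-, ho₂⟩, hn, hε, hε', hI, rfl⟩ := h
  rw [← ho₁, ← ho₂]
  refine ⟨⟨p, v₁, v₂, ⟨hp, rfl⟩, ⟨hp, rfl⟩⟩, hI.meanEnergy_le h₁ h₂ h12 hn hε hε' p p,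
    hI.meanAngMom_eq h12 ?_⟩
  rw [sub_self]
  simp [cross]

theorem reflTransGen_orbitStep_invariants {μ₁ μ₂ : ℝ} (h₁ : 0 < μ₁) (h₂ : 0 < μ₂)
    (h12 : μ₁ + μ₂ = 1) {o o' : Orbit × Orbit}
    (h : Relation.ReflTransGen (OrbitStep μ₁ μ₂) o o') (ho : Intersect o.1 o.2) :
    Intersect o'.1 o'.2 ∧ meanEnergy μ₁ μ₂ o'.1 o'.2 ≤ meanEnergy μ₁ μ₂ o.1 o.2 ∧
      meanAngMom μ₁ μ₂ o'.1 o'.2 = meanAngMom μ₁ μ₂ o.1 o.2 := by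
  induction h with
  | refl => exact ⟨ho, le_rfl, rfl⟩
  | tail _ hstep ih =>
    obtain ⟨i₁, i₂, i₃⟩ := hstep.invariants h₁ h₂ h12
    exact ⟨i₁, i₂.trans ih.2.1, i₃.trans ih.2.2⟩

theorem orbits_bounded {μ₁ μ₂ E ℓ : ℝ} (h₁ : 0 < μ₁) (h : μ₁ ≤ μ₂) (h12 : μ₁ + μ₂ = 1)
    (hσ : E * ℓ ^ 2 < sigma μ₁ μ₂) :
    ∃ c₁ c₂ B : ℝ, c₁ < 1 ∧ c₂ < 1 ∧ ∀ o₁ o₂ : Orbit, Intersect o₁ o₂ →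
      meanEnergy μ₁ μ₂ o₁ o₂ = E → ‖meanAngMom μ₁ μ₂ o₁ o₂‖ = ℓ →
      ∀ o₁' o₂' : Orbit, Relation.ReflTransGen (OrbitStep μ₁ μ₂) (o₁, o₂) (o₁', o₂') →
        Intersect o₁' o₂' ∧
        meanEnergy μ₁ μ₂ o₁' o₂' * ‖meanAngMom μ₁ μ₂ o₁' o₂'‖ ^ 2 < sigma μ₁ μ₂ ∧
        o₁'.IsElliptic ∧ o₂'.IsElliptic ∧ o₁'.ecc ≤ c₁ ∧ o₂'.ecc ≤ c₂ ∧
        ‖o₁'.angMom‖ ≤ B ∧ ‖o₂'.angMom‖ ≤ B := by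
  have h₂ : 0 < μ₂ := h₁.trans_le h
  obtain ⟨d, c, B, hd, hc, H⟩ := exists_uniform_bounds h₁ h h12 hσ
  refine ⟨c, c, B, hc, hc, fun o₁ o₂ hint hE hL o₁' o₂' hR => ?_⟩
  obtain ⟨hint', hE', hL'⟩ := reflTransGen_orbitStep_invariants h₁ h₂ h12 hR hint
  simp only at hint' hE' hL'
  rw [hE] at hE'
  replace hL' : ‖meanAngMom μ₁ μ₂ o₁' o₂'‖ = ℓ := by rw [hL', hL]
  have hσ' : meanEnergy μ₁ μ₂ o₁' o₂' * ‖meanAngMom μ₁ μ₂ o₁' o₂'‖ ^ 2 < sigma μ₁ μ₂ := by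
    rw [hL']
    exact (mul_le_mul_of_nonneg_right hE' (sq_nonneg ℓ)).trans_lt hσ
  refine ⟨hint', hσ', ?_⟩
  obtain ⟨p, v₁, v₂, ⟨hp, rfl⟩, ⟨-, rfl⟩⟩ := hint'
  obtain ⟨ell₁, ell₂⟩ := elliptic_of_lt_sigma h₁ h h12 hp hσ'
  have hr := (norm_lower_bound h₁ h₂ h12 hp hp (D := 0) (by simp) ell₁.1.le ell₂.1.le).1
  rw [hL'] at hr
  have hr' : ℓ ^ 2 / 4 ≤ ‖p‖ := by linarith [sq_nonneg ℓ]
  obtain ⟨⟨-, a₁, b₁⟩, ⟨-, a₂, b₂⟩⟩ := H p p v₁ v₂ hr' hr' (by simpa using hd.le)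
    (by linarith) hL'
  exact ⟨ell₁, ell₂, a₁, a₂, b₁, b₂⟩

/-! ### Energy and angular momentum along a motion -/

theorem hasDerivWithinAt_angMom {x v : ℝ → E3} {a : E3} {s : Set ℝ} {t : ℝ}
    (hx : HasDerivWithinAt x (v t) s t) (hv : HasDerivWithinAt v a s t) :
    HasDerivWithinAt (fun τ => angMom (x τ) (v τ)) (cross (x t) a) s t := by
  have h := (isBoundedBilinearMap_cross.hasFDerivAt (x t, v t)).comp_hasDerivWithinAt t
    (hx.prodMk hv)
  refine h.congr_deriv ?_
  simp [cross_self_eq_zero]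

theorem hasDerivWithinAt_energy {x v : ℝ → E3} {a : E3} {s : Set ℝ} {t : ℝ} (h0 : x t ≠ 0)
    (hx : HasDerivWithinAt x (v t) s t) (hv : HasDerivWithinAt v a s t) :
    HasDerivWithinAt (fun τ => energy (x τ) (v τ)) ⟪v t, a - gravity (x t)⟫ s t := by
  have hr : ‖x t‖ ≠ 0 := norm_ne_zero_iff.2 h0
  have hn : HasDerivWithinAt (fun τ => ‖x τ‖) (⟪x t, v t⟫ / ‖x t‖) s t := by
    have h2 : HasDerivWithinAt (fun τ => √(‖x τ‖ ^ 2)) _ s t :=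
      hx.norm_sq.sqrt (pow_ne_zero 2 hr)
    simp only [Real.sqrt_sq (norm_nonneg _)] at h2
    refine h2.congr_deriv ?_
    field_simp
  have h3 := (hv.norm_sq.div_const 2).sub (hn.inv hr)
  simp only [energy, one_div]
  refine h3.congr_deriv ?_
  simp only [gravity, inner_sub_right, real_inner_smul_right, inner_neg_right, neg_smul]
  rw [real_inner_comm (v t) (x t)]
  field_simp

theorem cross_gravity (x : E3) : cross x (gravity x) = 0 := by
  rw [gravity, cross_smul_right, cross_self_eq_zero, smul_zero]

/-- Energy and angular momentum, as a function of the state. -/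
noncomputable def elements (x v : E3) : ℝ × E3 := (energy x v, angMom x v)

theorem hasDerivWithinAt_elements {x v : ℝ → E3} {s : Set ℝ} {t : ℝ} (h0 : x t ≠ 0)
    (hx : HasDerivWithinAt x (v t) s t) (hv : HasDerivWithinAt v (gravity (x t)) s t) :
    HasDerivWithinAt (fun τ => elements (x τ) (v τ)) 0 s t := by
  have h := (hasDerivWithinAt_energy h0 hx hv).prodMk (hasDerivWithinAt_angMom hx hv)
  rwa [sub_self, inner_zero_right, cross_gravity] at h

theorem tendsto_elements {α : Type*} {l : Filter α} {x v : α → E3} {a b : E3} (h0 : a ≠ 0)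
    (hx : Filter.Tendsto x l (𝓝 a)) (hv : Filter.Tendsto v l (𝓝 b)) :
    Filter.Tendsto (fun τ => elements (x τ) (v τ)) l (𝓝 (elements a b)) := by
  have hxv : Filter.Tendsto (fun τ => (x τ, v τ)) l (𝓝 (a, b)) := hx.prodMk_nhds hv
  have hopen : {p : E3 × E3 | p.1 ≠ 0} ∈ 𝓝 (a, b) :=
    (isOpen_ne_fun continuous_fst continuous_const).mem_nhds h0
  have hE : ContinuousAt (fun p : E3 × E3 => energy p.1 p.2) (a, b) :=
    continuousOn_energy.continuousAt hopen
  have hL : ContinuousAt (fun p : E3 × E3 => angMom p.1 p.2) (a, b) :=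
    continuous_angMom.continuousAt
  have h : ContinuousAt (fun p : E3 × E3 => elements p.1 p.2) (a, b) := hE.prodMk hL
  exact Filter.Tendsto.comp (f := fun τ => (x τ, v τ)) (g := fun p : E3 × E3 => elements p.1 p.2)
    (y := 𝓝 (a, b)) h.tendsto hxv

theorem eq_of_hasDerivWithinAt_zero {G : Type*} [NormedAddCommGroup G] [NormedSpace ℝ G]
    {F : ℝ → G} {I : Set ℝ} (hI : Convex ℝ I) (hF : ∀ τ ∈ I, HasDerivWithinAt F 0 I τ) {s t : ℝ}
    (hs : s ∈ I) (ht : t ∈ I) : F s = F t := by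
  have h := hI.norm_image_sub_le_of_norm_hasDerivWithin_le (C := 0) hF (by simp) ht hs
  rw [zero_mul] at h
  exact sub_eq_zero.1 (norm_le_zero_iff.1 h)

/-- A function with derivative zero on an open interval has the same limits at its end points. -/
theorem eq_of_tendsto_of_hasDerivAt_zero {G : Type*} [NormedAddCommGroup G] [NormedSpace ℝ G]
    {F : ℝ → G} {s t : ℝ} (hst : s < t) {A B : G} (hF : ∀ τ ∈ Set.Ioo s t, HasDerivAt F 0 τ)
    (hA : Filter.Tendsto F (𝓝[>] s) (𝓝 A)) (hB : Filter.Tendsto F (𝓝[<] t) (𝓝 B)) : A = B := by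
  have hconst : ∀ τ ∈ Set.Ioo s t, F ((s + t) / 2) = F τ := fun τ hτ =>
    eq_of_hasDerivWithinAt_zero (convex_Ioo s t) (fun y hy => (hF y hy).hasDerivWithinAt)
      ⟨by linarith, by linarith⟩ hτ
  have hA' : Filter.Tendsto F (𝓝[>] s) (𝓝 (F ((s + t) / 2))) :=
    tendsto_const_nhds.congr' (Filter.mem_of_superset (Ioo_mem_nhdsGT hst) hconst)
  have hB' : Filter.Tendsto F (𝓝[<] t) (𝓝 (F ((s + t) / 2))) :=
    tendsto_const_nhds.congr' (Filter.mem_of_superset (Ioo_mem_nhdsLT hst) hconst)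
  exact (tendsto_nhds_unique hA hA').trans (tendsto_nhds_unique hB' hB)

/-! ### Hard spheres -/

/-- Energy and angular momentum are the same just after the time `s` and just before the time
`t`, if the motion is free in between. -/
theorem elements_eq_of_free {x v : ℝ → E3} {I : Set ℝ} (hI : I.OrdConnected) {s t : ℝ}
    (hs : s ∈ I) (ht : t ∈ I) (hst : s < t) (hx : ContinuousOn x I) (h0 : ∀ τ ∈ I, x τ ≠ 0)
    (hfree : ∀ τ ∈ Set.Ioo s t,
      HasDerivWithinAt x (v τ) I τ ∧ HasDerivWithinAt v (gravity (x τ)) I τ)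
    (hvs : ContinuousWithinAt v (I ∩ Set.Ici s) s) {w : E3}
    (hvt : Filter.Tendsto v (𝓝[I ∩ Set.Iio t] t) (𝓝 w)) :
    elements (x s) (v s) = elements (x t) w := by
  have hsub : Set.Ioo s t ⊆ I := fun τ hτ => hI.out hs ht ⟨hτ.1.le, hτ.2.le⟩
  have hls : 𝓝[>] s ≤ 𝓝[I ∩ Set.Ici s] s := nhdsWithin_le_of_mem
    (Filter.mem_of_superset (Ioo_mem_nhdsGT hst) fun τ hτ => ⟨hsub hτ, hτ.1.le⟩)
  have hlt : 𝓝[<] t ≤ 𝓝[I ∩ Set.Iio t] t := nhdsWithin_le_of_mem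
    (Filter.mem_of_superset (Ioo_mem_nhdsLT hst) fun τ hτ => ⟨hsub hτ, hτ.2⟩)
  have hxs : Filter.Tendsto x (𝓝[>] s) (𝓝 (x s)) :=
    ((hx s hs).mono Set.inter_subset_left).tendsto.mono_left hls
  have hxt : Filter.Tendsto x (𝓝[<] t) (𝓝 (x t)) :=
    ((hx t ht).mono Set.inter_subset_left).tendsto.mono_left hlt
  refine eq_of_tendsto_of_hasDerivAt_zero (F := fun τ => elements (x τ) (v τ)) hst ?_
    (tendsto_elements (h0 s hs) hxs (hvs.tendsto.mono_left hls))
    (tendsto_elements (h0 t ht) hxt (hvt.mono_left hlt))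
  intro τ hτ
  obtain ⟨h1, h2⟩ := hfree τ hτ
  exact (hasDerivWithinAt_elements (h0 τ (hsub hτ)) h1 h2).hasDerivAt
    (Filter.mem_of_superset (isOpen_Ioo.mem_nhds hτ) hsub)

theorem HardSphereMotion.elements_eq {μ₁ μ₂ D : ℝ} {I C : Set ℝ} {x₁ x₂ u₁ u₂ v₁ v₂ : ℝ → E3}
    (h : HardSphereMotion μ₁ μ₂ D I C x₁ x₂ u₁ u₂ v₁ v₂) {s t : ℝ} (hs : s ∈ I) (ht : t ∈ I)
    (hst : s < t) (hC : ∀ τ ∈ Set.Ioo s t, τ ∉ C) :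
    elements (x₁ s) (v₁ s) = elements (x₁ t) (u₁ t) ∧
      elements (x₂ s) (v₂ s) = elements (x₂ t) (u₂ t) := by
  have hsub : Set.Ioo s t ⊆ I := fun τ hτ => h.ordConnected.out hs ht ⟨hτ.1.le, hτ.2.le⟩
  have hvs : ContinuousWithinAt v₁ (I ∩ Set.Ici s) s ∧ ContinuousWithinAt v₂ (I ∩ Set.Ici s) s := by
    by_cases hsC : s ∈ C
    · exact h.after s hsC
    · obtain ⟨-, -, -, -, h1, h2⟩ := h.free s ⟨hs, hsC⟩
      exact ⟨h1.continuousWithinAt.mono Set.inter_subset_left,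
        h2.continuousWithinAt.mono Set.inter_subset_left⟩
  have hvt : Filter.Tendsto v₁ (𝓝[I ∩ Set.Iio t] t) (𝓝 (u₁ t)) ∧
      Filter.Tendsto v₂ (𝓝[I ∩ Set.Iio t] t) (𝓝 (u₂ t)) := by
    by_cases htC : t ∈ C
    · exact h.before t htC
    · obtain ⟨e1, e2, -, -, h1, h2⟩ := h.free t ⟨ht, htC⟩
      rw [e1, e2]
      exact ⟨h1.continuousWithinAt.mono Set.inter_subset_left,
        h2.continuousWithinAt.mono Set.inter_subset_left⟩
  constructor
  · refine elements_eq_of_free h.ordConnected hs ht hst h.continuousOn.1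
      (fun τ hτ => (h.ne_zero τ hτ).1) (fun τ hτ => ?_) hvs.1 hvt.1
    obtain ⟨-, -, a1, -, a2, -⟩ := h.free τ ⟨hsub hτ, hC τ hτ⟩
    exact ⟨a1, a2⟩
  · refine elements_eq_of_free h.ordConnected hs ht hst h.continuousOn.2
      (fun τ hτ => (h.ne_zero τ hτ).2) (fun τ hτ => ?_) hvs.2 hvt.2
    obtain ⟨-, -, -, a1, -, a2⟩ := h.free τ ⟨hsub hτ, hC τ hτ⟩
    exact ⟨a1, a2⟩

/-- Induction along a motion of hard spheres: a property of energies and angular momenta that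
holds initially and is preserved by the collisions holds at all times, before and after the
collision if there is one. -/
theorem HardSphereMotion.induction {μ₁ μ₂ D : ℝ} {I C : Set ℝ} {x₁ x₂ u₁ u₂ v₁ v₂ : ℝ → E3}
    (h : HardSphereMotion μ₁ μ₂ D I C x₁ x₂ u₁ u₂ v₁ v₂) (P : ℝ × E3 → ℝ × E3 → Prop)
    (h0 : P (elements (x₁ 0) (u₁ 0)) (elements (x₂ 0) (u₂ 0)))
    (hcoll : ∀ t ∈ C, P (elements (x₁ t) (u₁ t)) (elements (x₂ t) (u₂ t)) →
      P (elements (x₁ t) (v₁ t)) (elements (x₂ t) (v₂ t))) :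
    ∀ t ∈ I, P (elements (x₁ t) (u₁ t)) (elements (x₂ t) (u₂ t)) ∧
      P (elements (x₁ t) (v₁ t)) (elements (x₂ t) (v₂ t)) := by
  have hafter : ∀ t ∈ I, P (elements (x₁ t) (u₁ t)) (elements (x₂ t) (u₂ t)) →
      P (elements (x₁ t) (v₁ t)) (elements (x₂ t) (v₂ t)) := by
    intro t ht hP
    by_cases htC : t ∈ C
    · exact hcoll t htC hP
    · obtain ⟨e1, e2, -⟩ := h.free t ⟨ht, htC⟩
      rwa [e1, e2] at hP
  have key : ∀ n : ℕ, ∀ t ∈ I, (C ∩ Set.Ico 0 t).ncard = n →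
      P (elements (x₁ t) (u₁ t)) (elements (x₂ t) (u₂ t)) := by
    intro n
    induction n using Nat.strong_induction_on with
    | _ n ih =>
      intro t ht hn
      have h0I : (0 : ℝ) ∈ I := h.isLeast.1
      have ht0 : 0 ≤ t := h.isLeast.2 ht
      rcases ht0.eq_or_lt with rfl | htpos
      · exact h0
      have hfin : (C ∩ Set.Ico 0 t).Finite :=
        (h.locally_finite t ht).subset
          (Set.inter_subset_inter_right _ Set.Ico_subset_Icc_self)
      rcases (C ∩ Set.Ico 0 t).eq_empty_or_nonempty with hem | hne
      · obtain ⟨e1, e2⟩ := h.elements_eq h0I ht htpos fun τ hτ hτC =>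
          (hem ▸ (⟨hτC, hτ.1.le, hτ.2⟩ : τ ∈ C ∩ Set.Ico 0 t) : τ ∈ (∅ : Set ℝ))
        rw [← e1, ← e2]
        exact hafter 0 h0I h0
      · -- the last collision before the time `t`
        obtain ⟨s, hs, hmax⟩ := Set.exists_max_image _ id hfin hne
        have hsI := h.subset hs.1
        obtain ⟨e1, e2⟩ := h.elements_eq hsI ht hs.2.2 fun τ hτ hτC =>
          (hmax τ ⟨hτC, hs.2.1.trans hτ.1.le, hτ.2⟩).not_gt hτ.1
        rw [← e1, ← e2]
        refine hafter s hsI (ih _ ?_ s hsI rfl)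
        rw [← hn]
        refine Set.ncard_lt_ncard ⟨?_, fun hsub => ?_⟩ hfin
        · exact Set.inter_subset_inter_right _ (Set.Ico_subset_Ico_right hs.2.2.le)
        · exact lt_irrefl s (hsub hs).2.2
  exact fun t ht => ⟨key _ t ht rfl, hafter t ht (key _ t ht rfl)⟩

/-- The orbit with energy and angular momentum `q`. The eccentricity vector does not matter for
its shape, and is set to zero. -/
def shape (q : ℝ × E3) : Orbit := ⟨q.1, q.2, 0⟩

/-- A property of the shapes of two orbits which is preserved by collisions and by the free
motion. -/
def Admissible (μ₁ μ₂ E ℓ c₁ c₂ B₁ B₂ : ℝ) (q₁ q₂ : ℝ × E3) : Prop :=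
  meanEnergy μ₁ μ₂ (shape q₁) (shape q₂) ≤ E ∧ ‖meanAngMom μ₁ μ₂ (shape q₁) (shape q₂)‖ = ℓ ∧
    (shape q₁).BoundedBy c₁ B₁ ∧ (shape q₂).BoundedBy c₂ B₂

theorem hardSpheres_bounded {μ₁ μ₂ E ℓ : ℝ} (h₁ : 0 < μ₁) (h : μ₁ ≤ μ₂) (h12 : μ₁ + μ₂ = 1)
    (hσ : E * ℓ ^ 2 < sigma μ₁ μ₂) :
    ∃ D₀ c₁ c₂ B : ℝ, 0 < D₀ ∧ c₁ < 1 ∧ c₂ < 1 ∧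
      ∀ R₁ R₂ : ℝ, 0 ≤ R₁ → 0 ≤ R₂ → 0 < R₁ + R₂ → R₁ + R₂ ≤ D₀ →
      ∀ (I C : Set ℝ) (x₁ x₂ u₁ u₂ v₁ v₂ : ℝ → E3),
        HardSphereMotion μ₁ μ₂ (R₁ + R₂) I C x₁ x₂ u₁ u₂ v₁ v₂ →
        (osculating (x₁ 0) (u₁ 0)).IsElliptic → (osculating (x₂ 0) (u₂ 0)).IsElliptic →
        meanEnergy μ₁ μ₂ (osculating (x₁ 0) (u₁ 0)) (osculating (x₂ 0) (u₂ 0)) = E →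
        ‖meanAngMom μ₁ μ₂ (osculating (x₁ 0) (u₁ 0)) (osculating (x₂ 0) (u₂ 0))‖ = ℓ →
        ∀ t ∈ I, ∀ w₁ w₂ : E3, (w₁ = u₁ t ∧ w₂ = u₂ t) ∨ (w₁ = v₁ t ∧ w₂ = v₂ t) →
          meanEnergy μ₁ μ₂ (osculating (x₁ t) w₁) (osculating (x₂ t) w₂)
              * ‖meanAngMom μ₁ μ₂ (osculating (x₁ t) w₁) (osculating (x₂ t) w₂)‖ ^ 2
            < sigma μ₁ μ₂ ∧
          Orbit.Controlled c₁ B (osculating (x₁ 0) (u₁ 0)) (osculating (x₁ t) w₁) ∧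
          Orbit.Controlled c₂ B (osculating (x₂ 0) (u₂ 0)) (osculating (x₂ t) w₂) := by
  have h₂ : 0 < μ₂ := h₁.trans_le h
  obtain ⟨-, hℓ⟩ := neg_and_sq_pos_of_lt_sigma h₁ h₂ hσ
  obtain ⟨d, c, B, hd, hc, H⟩ := exists_uniform_bounds h₁ h h12 hσ
  refine ⟨min d (ℓ ^ 2 / 4), c, c, B, lt_min hd (by positivity), hc, hc, ?_⟩
  intro R₁ R₂ _ _ hD0 hD I C x₁ x₂ u₁ u₂ v₁ v₂ hM ell₁ ell₂ hE hL t ht w₁ w₂ hw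
  obtain ⟨hDd, hDℓ⟩ := le_min_iff.1 hD
  generalize R₁ + R₂ = D at *
  set c₁ := max c (osculating (x₁ 0) (u₁ 0)).ecc
  set c₂ := max c (osculating (x₂ 0) (u₂ 0)).ecc
  set B₁ := max B ‖(osculating (x₁ 0) (u₁ 0)).angMom‖
  set B₂ := max B ‖(osculating (x₂ 0) (u₂ 0)).angMom‖
  have hadm := hM.induction (Admissible μ₁ μ₂ E ℓ c₁ c₂ B₁ B₂)
    ⟨hE.le, hL, ⟨ell₁, le_max_right _ _, le_max_right _ _⟩,
      ⟨ell₂, le_max_right _ _, le_max_right _ _⟩⟩ ?_ t ht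
  · have hadm' : Admissible μ₁ μ₂ E ℓ c₁ c₂ B₁ B₂ (elements (x₁ t) w₁) (elements (x₂ t) w₂) := by
      rcases hw with ⟨rfl, rfl⟩ | ⟨rfl, rfl⟩
      · exact hadm.1
      · exact hadm.2
    obtain ⟨hE', hL', b₁, b₂⟩ := hadm'
    refine ⟨?_, b₁, b₂⟩
    have hL'' : ‖meanAngMom μ₁ μ₂ (osculating (x₁ t) w₁) (osculating (x₂ t) w₂)‖ = ℓ := hL'
    rw [hL'']
    exact (mul_le_mul_of_nonneg_right hE' (sq_nonneg ℓ)).trans_lt hσ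
  · rintro s hs ⟨hE', hL', b₁, b₂⟩
    obtain ⟨hx, -, ε, hε, hε', hI⟩ := hM.collision s hs
    obtain ⟨hx₁, hx₂⟩ := hM.ne_zero s (hM.subset hs)
    have hL'' : ‖meanAngMom μ₁ μ₂ (osculating (x₁ s) (u₁ s)) (osculating (x₂ s) (u₂ s))‖ = ℓ := hL'
    have hE'' : meanEnergy μ₁ μ₂ (osculating (x₁ s) (u₁ s)) (osculating (x₂ s) (u₂ s)) ≤ E := hE'
    -- before the collision both energies are negative, so that the bodies are not near the centre
    obtain ⟨r₁, r₂⟩ := norm_lower_bound h₁ h₂ h12 hx₁ hx₂ hx.le b₁.1.1.le b₂.1.1.le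
    rw [hL''] at r₁ r₂
    have hn : ‖D⁻¹ • (x₁ s - x₂ s)‖ = 1 := by
      rw [norm_smul, hx, Real.norm_of_nonneg (by positivity), inv_mul_cancel₀ hD0.ne']
    have hEv := (hI.meanEnergy_le h₁ h₂ h12 hn hε hε' (x₁ s) (x₂ s)).trans hE''
    have hLv : ‖meanAngMom μ₁ μ₂ (osculating (x₁ s) (v₁ s)) (osculating (x₂ s) (v₂ s))‖ = ℓ := by
      rw [hI.meanAngMom_eq h12 (by rw [cross_smul_right, cross_self_eq_zero, smul_zero]), hL'']
    obtain ⟨a₁, a₂⟩ := H _ _ _ _ (by linarith) (by linarith) (hx.le.trans hDd)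
      (hEv.trans (by linarith)) hLv
    exact ⟨hEv, hLv, a₁.mono (le_max_left _ _) (le_max_left _ _),
      a₂.mono (le_max_left _ _) (le_max_left _ _)⟩

/-! ### Radial potentials -/

/-- The gradient of a radial function is radial. -/
theorem cross_gradient_eq_zero {V : ℝ → ℝ} {g z : E3}
    (h : HasGradientAt (fun y : E3 => V ‖y‖) g z) : cross z g = 0 := by
  have horth : ∀ w : E3, ⟪z, w⟫ = 0 → ⟪g, w⟫ = 0 := by
    intro w hw
    have hF : HasFDerivAt (fun y : E3 => V ‖y‖) (InnerProductSpace.toDual ℝ E3 g)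
        (z + (0 : ℝ) • w) := by
      rw [zero_smul, add_zero]; exact h
    have hline : HasDerivAt (fun s : ℝ => z + s • w) w 0 := by
      simpa using ((hasDerivAt_id (0 : ℝ)).smul_const w).const_add z
    have h1 : HasDerivAt (fun s : ℝ => V ‖z + s • w‖) ⟪g, w⟫ 0 :=
      HasFDerivAt.comp_hasDerivAt (f := fun s : ℝ => z + s • w) 0 hF hline
    -- the function is even on the line through `z` in the direction of `w`
    have heven : ∀ s : ℝ, ‖z + (-s) • w‖ = ‖z + s • w‖ := by
      intro s
      rw [neg_smul, ← sub_eq_add_neg]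
      have : ⟪z, s • w⟫ = 0 := by rw [real_inner_smul_right, hw, mul_zero]
      rw [← pow_left_inj₀ (norm_nonneg _) (norm_nonneg _) two_ne_zero, norm_sub_sq_real,
        norm_add_sq_real, this]
      ring
    have h2 : HasDerivAt (fun s : ℝ => V ‖z + s • w‖) (-⟪g, w⟫) 0 := by
      have h1' : HasDerivAt (fun s : ℝ => V ‖z + s • w‖) ⟪g, w⟫ (-0) := by rwa [neg_zero]
      have := h1'.scomp 0 (hasDerivAt_neg (0 : ℝ))
      simp only [Function.comp_def, heven] at this
      simpa using this
    have := h1.unique h2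
    linarith
  by_cases hz : z = 0
  · rw [hz]; simp [cross]
  have hzz : ⟪z, z⟫ ≠ 0 := inner_self_ne_zero.2 hz
  set k : ℝ := ⟪z, g⟫ / ⟪z, z⟫ with hk
  have hw : ⟪z, g - k • z⟫ = 0 := by
    rw [inner_sub_right, real_inner_smul_right, hk]
    field_simp
    ring
  have hg := horth _ hw
  have h0 : g - k • z = 0 := by
    rw [← inner_self_eq_zero (𝕜 := ℝ), inner_sub_left, real_inner_smul_left, hg, hw]
    simp
  rw [sub_eq_zero.1 h0, cross_smul_right, cross_self_eq_zero, smul_zero]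

theorem gradient_eq_zero_of_lt {V : ℝ → ℝ} {D : ℝ} (hV : ∀ r, D ≤ r → V r = 0) {g z : E3}
    (hz : D < ‖z‖) (h : HasGradientAt (fun y : E3 => V ‖y‖) g z) : g = 0 := by
  have hev : (fun y : E3 => V ‖y‖) =ᶠ[𝓝 z] fun _ => (0 : ℝ) := by
    filter_upwards [continuous_norm.continuousAt.eventually (lt_mem_nhds hz)] with y hy
    exact hV _ (le_of_lt hy)
  have h0 : HasGradientAt (fun y : E3 => V ‖y‖) 0 z :=
    (hasGradientAt_const z (0 : ℝ)).congr_of_eventuallyEq hev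
  exact h.unique h0

/-- The lower bound of the potential holds also at `r = 0`, if the potential is differentiable at
the origin. -/
theorem potential_lower_bound {V : ℝ → ℝ} {U : ℝ} (hV : ∀ r, 0 < r → -U ≤ V r) {g z : E3}
    (h : HasGradientAt (fun y : E3 => V ‖y‖) g z) : -U ≤ V ‖z‖ := by
  by_cases hz : z = 0
  · have hc : ContinuousAt (fun y : E3 => V ‖y‖) z := h.continuousAt
    have ht : Filter.Tendsto (fun y : E3 => V ‖y‖) (𝓝[≠] z) (𝓝 (V ‖z‖)) :=
      hc.tendsto.mono_left nhdsWithin_le_nhds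
    refine ge_of_tendsto ht ?_
    filter_upwards [self_mem_nhdsWithin] with y hy
    exact hV _ (norm_pos_iff.2 fun h0 => hy (by rw [h0, hz]; rfl))
  · exact hV _ (norm_pos_iff.2 hz)

/-! ### Interacting point particles -/

theorem PotentialMotion.interactingEnergy_eq {m₁ m₂ : ℝ} (hm₁ : 0 < m₁) (hm₂ : 0 < m₂)
    {V : ℝ → ℝ} {I : Set ℝ} {x₁ x₂ v₁ v₂ : ℝ → E3} (h : PotentialMotion m₁ m₂ V I x₁ x₂ v₁ v₂)
    {t : ℝ} (ht : t ∈ I) :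
    interactingEnergy m₁ m₂ V (x₁ t) (x₂ t) (v₁ t) (v₂ t)
      = interactingEnergy m₁ m₂ V (x₁ 0) (x₂ 0) (v₁ 0) (v₂ 0) := by
  refine eq_of_hasDerivWithinAt_zero (I := I)
    (F := fun τ => interactingEnergy m₁ m₂ V (x₁ τ) (x₂ τ) (v₁ τ) (v₂ τ))
    h.ordConnected.convex ?_ ht h.zero_mem
  intro τ hτ
  obtain ⟨g, hg, hv₁, hv₂⟩ := h.newton τ hτ
  obtain ⟨hx₁, hx₂⟩ := h.velocity τ hτ
  obtain ⟨n₁, n₂⟩ := h.ne_zero τ hτ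
  have hV : HasDerivWithinAt (fun s => V ‖x₁ s - x₂ s‖) ⟪g, v₁ τ - v₂ τ⟫ I τ :=
    hg.hasFDerivAt.comp_hasDerivWithinAt (f := fun s => x₁ s - x₂ s) τ (hx₁.sub hx₂)
  have hE := (((hasDerivWithinAt_energy n₁ hx₁ hv₁).const_mul (m₁ / (m₁ + m₂))).add
    ((hasDerivWithinAt_energy n₂ hx₂ hv₂).const_mul (m₂ / (m₁ + m₂)))).add
    (hV.div_const (m₁ + m₂))
  refine hE.congr_deriv ?_
  rw [sub_sub_cancel_left, add_sub_cancel_left, inner_neg_right, real_inner_smul_right,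
    real_inner_smul_right, inner_sub_right, real_inner_comm (v₁ τ), real_inner_comm (v₂ τ)]
  field_simp
  ring

theorem PotentialMotion.meanAngMom_eq {m₁ m₂ : ℝ} (hm₁ : 0 < m₁) (hm₂ : 0 < m₂)
    {V : ℝ → ℝ} {I : Set ℝ} {x₁ x₂ v₁ v₂ : ℝ → E3} (h : PotentialMotion m₁ m₂ V I x₁ x₂ v₁ v₂)
    {t : ℝ} (ht : t ∈ I) :
    meanAngMom (m₁ / (m₁ + m₂)) (m₂ / (m₁ + m₂)) (osculating (x₁ t) (v₁ t))
        (osculating (x₂ t) (v₂ t))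
      = meanAngMom (m₁ / (m₁ + m₂)) (m₂ / (m₁ + m₂)) (osculating (x₁ 0) (v₁ 0))
        (osculating (x₂ 0) (v₂ 0)) := by
  refine eq_of_hasDerivWithinAt_zero (I := I)
    (F := fun τ => meanAngMom (m₁ / (m₁ + m₂)) (m₂ / (m₁ + m₂)) (osculating (x₁ τ) (v₁ τ))
        (osculating (x₂ τ) (v₂ τ))) h.ordConnected.convex ?_ ht h.zero_mem
  intro τ hτ
  obtain ⟨g, hg, hv₁, hv₂⟩ := h.newton τ hτ
  obtain ⟨hx₁, hx₂⟩ := h.velocity τ hτ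
  have hL := ((hasDerivWithinAt_angMom hx₁ hv₁).const_smul (m₁ / (m₁ + m₂))).add
    ((hasDerivWithinAt_angMom hx₂ hv₂).const_smul (m₂ / (m₁ + m₂)))
  refine hL.congr_deriv ?_
  have hx := cross_gradient_eq_zero hg
  rw [cross_sub_left, sub_eq_zero] at hx
  rw [cross_sub_right, cross_add_right, cross_gravity, cross_gravity, cross_smul_right,
    cross_smul_right, hx, zero_sub, zero_add, smul_neg, smul_smul, smul_smul, ← neg_smul,
    ← add_smul]
  have : -(m₁ / (m₁ + m₂) * m₁⁻¹) + m₂ / (m₁ + m₂) * m₂⁻¹ = 0 := by field_simp; ring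
  rw [this, zero_smul]

/-- A property of the points of an interval which is locally preserved and closed holds
everywhere, if it holds at a point. -/
theorem forall_of_ordConnected {I : Set ℝ} (hI : I.OrdConnected) {P : ℝ → Prop} {t₀ : ℝ}
    (ht₀ : t₀ ∈ I) (h₀ : P t₀) (hopen : ∀ t ∈ I, P t → ∀ᶠ s in 𝓝[I] t, P s)
    (hclosed : ∀ t ∈ I, (∃ᶠ s in 𝓝[I] t, P s) → P t) : ∀ t ∈ I, P t := by
  have : PreconnectedSpace I := isPreconnected_iff_preconnectedSpace.1 hI.isPreconnected
  have hclopen : IsClopen {t : I | P t} := by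
    constructor
    · refine isClosed_iff_frequently.2 fun t ht => hclosed t t.2 ?_
      rw [← map_nhds_subtype_val, Filter.frequently_map]
      exact ht
    · refine isOpen_iff_eventually.2 fun t ht => ?_
      have := hopen t t.2 ht
      rwa [← map_nhds_subtype_val, Filter.eventually_map] at this
  have huniv := hclopen.eq_univ ⟨⟨t₀, ht₀⟩, h₀⟩
  intro t ht
  have : (⟨t, ht⟩ : I) ∈ {t : I | P t} := huniv ▸ Set.mem_univ _
  exact this

theorem Orbit.boundedBy_iff {c B : ℝ} (hc₀ : 0 ≤ c) (hc : c < 1) {o : Orbit} :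
    o.BoundedBy c B ↔ 1 + 2 * o.energy * ‖o.angMom‖ ^ 2 ≤ c ^ 2 ∧ ‖o.angMom‖ ≤ B := by
  constructor
  · rintro ⟨-, h1, h2⟩
    exact ⟨(Real.sqrt_le_left hc₀).1 h1, h2⟩
  · rintro ⟨h1, h2⟩
    refine ⟨.of_mul_neg ?_, (Real.sqrt_le_left hc₀).2 h1, h2⟩
    nlinarith

theorem isClosed_setOf_boundedBy {c B : ℝ} (hc₀ : 0 ≤ c) (hc : c < 1) :
    IsClosed {q : ℝ × E3 | (shape q).BoundedBy c B} := by
  simp only [Orbit.boundedBy_iff hc₀ hc]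
  have h₁ : IsClosed {q : ℝ × E3 | 1 + 2 * q.1 * ‖q.2‖ ^ 2 ≤ c ^ 2} :=
    isClosed_le (by fun_prop) continuous_const
  have h₂ : IsClosed {q : ℝ × E3 | ‖q.2‖ ≤ B} := isClosed_le (by fun_prop) continuous_const
  exact h₁.inter h₂

theorem Orbit.IsElliptic.ecc_lt_one {o : Orbit} (h : o.IsElliptic) : o.ecc < 1 := by
  rw [Orbit.ecc, Real.sqrt_lt' one_pos]
  have := h.mul_neg
  linarith

/-- The distance of the apocentre is bounded in terms of the eccentricity and the angular
momentum. -/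
theorem norm_le_of_boundedBy {c B : ℝ} (hc₀ : 0 ≤ c) (hc : c < 1) {x v : E3} (hx : x ≠ 0)
    (h : (osculating x v).BoundedBy c B) : ‖x‖ ≤ 2 * B ^ 2 / (1 - c ^ 2) := by
  obtain ⟨h1, h2⟩ := (Orbit.boundedBy_iff hc₀ hc).1 h
  have hr : 0 < ‖x‖ := norm_pos_iff.2 hx
  have h1' : 1 + 2 * energy x v * ‖angMom x v‖ ^ 2 ≤ c ^ 2 := h1
  have h2' : ‖angMom x v‖ ^ 2 ≤ B ^ 2 := pow_le_pow_left₀ (norm_nonneg _) h2 2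
  have hE : -1 ≤ ‖x‖ * energy x v := by
    have := energy_lower_bound (v := v) hx
    have := sq_nonneg (‖angMom x v‖ / √‖x‖)
    linarith
  rw [le_div_iff₀ (by nlinarith)]
  have h3 := mul_le_mul_of_nonneg_left h1' hr.le
  have h4 := mul_le_mul_of_nonneg_right hE (sq_nonneg ‖angMom x v‖)
  nlinarith

theorem PotentialMotion.continuousWithinAt_elements {m₁ m₂ : ℝ} {V : ℝ → ℝ} {I : Set ℝ}
    {x₁ x₂ v₁ v₂ : ℝ → E3} (h : PotentialMotion m₁ m₂ V I x₁ x₂ v₁ v₂) {t : ℝ} (ht : t ∈ I) :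
    ContinuousWithinAt (fun τ => elements (x₁ τ) (v₁ τ)) I t ∧
      ContinuousWithinAt (fun τ => elements (x₂ τ) (v₂ τ)) I t := by
  obtain ⟨g, -, hv₁, hv₂⟩ := h.newton t ht
  obtain ⟨hx₁, hx₂⟩ := h.velocity t ht
  obtain ⟨n₁, n₂⟩ := h.ne_zero t ht
  exact ⟨tendsto_elements n₁ hx₁.continuousWithinAt hv₁.continuousWithinAt,
    tendsto_elements n₂ hx₂.continuousWithinAt hv₂.continuousWithinAt⟩

/-- Energies and angular momenta are locally constant as long as the particles are not within the
range of the potential. -/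
theorem PotentialMotion.eventually_elements_eq {m₁ m₂ D : ℝ} {V : ℝ → ℝ} {I : Set ℝ}
    {x₁ x₂ v₁ v₂ : ℝ → E3} (h : PotentialMotion m₁ m₂ V I x₁ x₂ v₁ v₂)
    (hV : ∀ r, D ≤ r → V r = 0) {t : ℝ} (ht : t ∈ I) (hD : D < ‖x₁ t - x₂ t‖) :
    ∀ᶠ s in 𝓝[I] t, elements (x₁ s) (v₁ s) = elements (x₁ t) (v₁ t) ∧
      elements (x₂ s) (v₂ s) = elements (x₂ t) (v₂ t) := by
  have hcont : ContinuousWithinAt (fun s => ‖x₁ s - x₂ s‖) I t :=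
    ((h.velocity t ht).1.continuousWithinAt.sub (h.velocity t ht).2.continuousWithinAt).norm
  have hev := hcont.tendsto.eventually (lt_mem_nhds hD)
  obtain ⟨δ, hδ, hball⟩ := Metric.mem_nhdsWithin_iff.1 hev
  have hconv : Convex ℝ (Metric.ball t δ ∩ I) := (convex_ball t δ).inter h.ordConnected.convex
  have htm : t ∈ Metric.ball t δ ∩ I := ⟨Metric.mem_ball_self hδ, ht⟩
  have hderiv : ∀ τ ∈ Metric.ball t δ ∩ I,
      HasDerivWithinAt (fun s => elements (x₁ s) (v₁ s)) 0 (Metric.ball t δ ∩ I) τ ∧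
      HasDerivWithinAt (fun s => elements (x₂ s) (v₂ s)) 0 (Metric.ball t δ ∩ I) τ := by
    intro τ hτ
    have hDτ : D < ‖x₁ τ - x₂ τ‖ := hball hτ
    obtain ⟨g, hg, hv₁, hv₂⟩ := h.newton τ hτ.2
    obtain ⟨hx₁, hx₂⟩ := h.velocity τ hτ.2
    obtain ⟨n₁, n₂⟩ := h.ne_zero τ hτ.2
    rw [gradient_eq_zero_of_lt hV hDτ hg, smul_zero] at hv₁ hv₂
    rw [sub_zero] at hv₁
    rw [add_zero] at hv₂
    exact ⟨(hasDerivWithinAt_elements n₁ hx₁ hv₁).mono Set.inter_subset_right,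
      (hasDerivWithinAt_elements n₂ hx₂ hv₂).mono Set.inter_subset_right⟩
  have hmem : Metric.ball t δ ∩ I ∈ 𝓝[I] t :=
    Filter.inter_mem (mem_nhdsWithin_of_mem_nhds (Metric.ball_mem_nhds t hδ)) self_mem_nhdsWithin
  filter_upwards [hmem] with s hs
  exact ⟨eq_of_hasDerivWithinAt_zero hconv (fun τ hτ => (hderiv τ hτ).1) hs htm,
    eq_of_hasDerivWithinAt_zero hconv (fun τ hτ => (hderiv τ hτ).2) hs htm⟩

theorem pointParticles_bounded {m₁ m₂ E ℓ : ℝ} (hm₁ : 0 < m₁) (hm : m₁ ≤ m₂)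
    (hσ : E * ℓ ^ 2 < sigma (m₁ / (m₁ + m₂)) (m₂ / (m₁ + m₂))) :
    ∃ D₀ U₀ c₁ c₂ B : ℝ, 0 < D₀ ∧ 0 < U₀ ∧ c₁ < 1 ∧ c₂ < 1 ∧
      ∀ (D U : ℝ) (V : ℝ → ℝ), 0 < D → D ≤ D₀ → 0 ≤ U → U ≤ U₀ →
        (∀ r, D ≤ r → V r = 0) → (∀ r, 0 < r → -U ≤ V r) →
      ∀ (I : Set ℝ) (x₁ x₂ v₁ v₂ : ℝ → E3), PotentialMotion m₁ m₂ V I x₁ x₂ v₁ v₂ →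
        (osculating (x₁ 0) (v₁ 0)).IsElliptic → (osculating (x₂ 0) (v₂ 0)).IsElliptic →
        interactingEnergy m₁ m₂ V (x₁ 0) (x₂ 0) (v₁ 0) (v₂ 0) = E →
        ‖meanAngMom (m₁ / (m₁ + m₂)) (m₂ / (m₁ + m₂)) (osculating (x₁ 0) (v₁ 0))
          (osculating (x₂ 0) (v₂ 0))‖ = ℓ →
        (∀ t ∈ I,
          interactingEnergy m₁ m₂ V (x₁ t) (x₂ t) (v₁ t) (v₂ t)
              * ‖meanAngMom (m₁ / (m₁ + m₂)) (m₂ / (m₁ + m₂)) (osculating (x₁ t) (v₁ t))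
                (osculating (x₂ t) (v₂ t))‖ ^ 2
            < sigma (m₁ / (m₁ + m₂)) (m₂ / (m₁ + m₂)) ∧
          Orbit.Controlled c₁ B (osculating (x₁ 0) (v₁ 0)) (osculating (x₁ t) (v₁ t)) ∧
          Orbit.Controlled c₂ B (osculating (x₂ 0) (v₂ 0)) (osculating (x₂ t) (v₂ t))) ∧
        ∃ R : ℝ, ∀ t ∈ I, ‖x₁ t‖ ≤ R ∧ ‖x₂ t‖ ≤ R := by
  have hm₂ : 0 < m₂ := hm₁.trans_le hm
  have h₁ : 0 < m₁ / (m₁ + m₂) := by positivity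
  have h₂ : 0 < m₂ / (m₁ + m₂) := by positivity
  have h : m₁ / (m₁ + m₂) ≤ m₂ / (m₁ + m₂) := by gcongr
  have h12 : m₁ / (m₁ + m₂) + m₂ / (m₁ + m₂) = 1 := by field_simp
  obtain ⟨-, hℓ⟩ := neg_and_sq_pos_of_lt_sigma h₁ h₂ hσ
  obtain ⟨d, c, B, hd, hc, H⟩ := exists_uniform_bounds h₁ h h12 hσ
  refine ⟨min (d / 2) (ℓ ^ 2 / 8), d * (m₁ + m₂), c, c, B, lt_min (by positivity) (by positivity),
    by positivity, hc, hc, ?_⟩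
  intro D U V hD0 hD hU0 hU hV hVU I x₁ x₂ v₁ v₂ hM ell₁ ell₂ hE hL
  obtain ⟨hDd, hDℓ⟩ := le_min_iff.1 hD
  have hEt := fun t ht => (hM.interactingEnergy_eq hm₁ hm₂ (t := t) ht).trans hE
  have hLt : ∀ t ∈ I, ‖meanAngMom (m₁ / (m₁ + m₂)) (m₂ / (m₁ + m₂)) (osculating (x₁ t) (v₁ t))
      (osculating (x₂ t) (v₂ t))‖ = ℓ := fun t ht => by rw [hM.meanAngMom_eq hm₁ hm₂ ht, hL]
  obtain ⟨c₁, hc₁⟩ : ∃ c₁, c₁ = max c (osculating (x₁ 0) (v₁ 0)).ecc := ⟨_, rfl⟩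
  obtain ⟨c₂, hc₂⟩ : ∃ c₂, c₂ = max c (osculating (x₂ 0) (v₂ 0)).ecc := ⟨_, rfl⟩
  obtain ⟨B₁, hB₁⟩ : ∃ B₁, B₁ = max B ‖(osculating (x₁ 0) (v₁ 0)).angMom‖ := ⟨_, rfl⟩
  obtain ⟨B₂, hB₂⟩ : ∃ B₂, B₂ = max B ‖(osculating (x₂ 0) (v₂ 0)).angMom‖ := ⟨_, rfl⟩
  have hc₁0 : 0 ≤ c₁ := hc₁ ▸ (Real.sqrt_nonneg _).trans (le_max_right _ _)
  have hc₂0 : 0 ≤ c₂ := hc₂ ▸ (Real.sqrt_nonneg _).trans (le_max_right _ _)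
  have hc₁1 : c₁ < 1 := hc₁ ▸ max_lt hc ell₁.ecc_lt_one
  have hc₂1 : c₂ < 1 := hc₂ ▸ max_lt hc ell₂.ecc_lt_one
  have key : ∀ t ∈ I, (shape (elements (x₁ t) (v₁ t))).BoundedBy c₁ B₁ ∧
      (shape (elements (x₂ t) (v₂ t))).BoundedBy c₂ B₂ := by
    refine forall_of_ordConnected hM.ordConnected hM.zero_mem ?_ ?_ ?_
    · rw [hc₁, hc₂, hB₁, hB₂]
      exact ⟨⟨ell₁, le_max_right _ _, le_max_right _ _⟩,
        ⟨ell₂, le_max_right _ _, le_max_right _ _⟩⟩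
    · intro t ht hP
      rcases lt_or_ge D ‖x₁ t - x₂ t‖ with hlt | hge
      · filter_upwards [hM.eventually_elements_eq hV ht hlt] with s hs
        rw [hs.1, hs.2]
        exact hP
      · -- close to each other the particles are not near the centre, hence the uniform bounds
        -- hold, and they improve on those which are assumed at the time `t`
        obtain ⟨n₁, n₂⟩ := hM.ne_zero t ht
        obtain ⟨r₁, r₂⟩ := norm_lower_bound h₁ h₂ h12 n₁ n₂ hge hP.1.1.1.le hP.2.1.1.le
        rw [hLt t ht] at r₁ r₂
        have cx₁ := (hM.velocity t ht).1.continuousWithinAt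
        have cx₂ := (hM.velocity t ht).2.continuousWithinAt
        have ev₁ := cx₁.norm.tendsto.eventually
          (lt_mem_nhds (show ℓ ^ 2 / 4 < ‖x₁ t‖ by linarith))
        have ev₂ := cx₂.norm.tendsto.eventually
          (lt_mem_nhds (show ℓ ^ 2 / 4 < ‖x₂ t‖ by linarith))
        have ev₃ := (cx₁.sub cx₂).norm.tendsto.eventually
          (gt_mem_nhds (show ‖x₁ t - x₂ t‖ < d by linarith))
        filter_upwards [ev₁, ev₂, ev₃, self_mem_nhdsWithin] with s s₁ s₂ s₃ hs
        obtain ⟨g, hg, -⟩ := hM.newton s hs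
        have hVs : -d ≤ V ‖x₁ s - x₂ s‖ / (m₁ + m₂) := by
          rw [le_div_iff₀ (by positivity)]
          have := potential_lower_bound hVU hg
          linarith
        have hEs := hEt s hs
        rw [interactingEnergy] at hEs
        obtain ⟨b₁, b₂⟩ := H _ _ _ _ s₁.le s₂.le s₃.le (by linarith) (hLt s hs)
        rw [hc₁, hc₂, hB₁, hB₂]
        exact ⟨b₁.mono (le_max_left _ _) (le_max_left _ _),
          b₂.mono (le_max_left _ _) (le_max_left _ _)⟩
    · intro t ht hfreq
      obtain ⟨ct₁, ct₂⟩ := hM.continuousWithinAt_elements ht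
      exact ⟨(isClosed_setOf_boundedBy hc₁0 hc₁1).mem_of_frequently_of_tendsto
          (hfreq.mono fun _ hs => hs.1) ct₁.tendsto,
        (isClosed_setOf_boundedBy hc₂0 hc₂1).mem_of_frequently_of_tendsto
          (hfreq.mono fun _ hs => hs.2) ct₂.tendsto⟩
  refine ⟨fun t ht => ⟨?_, ?_, ?_⟩, ?_⟩
  · rw [hEt t ht, hLt t ht]
    exact hσ
  · have hk := (key t ht).1
    rw [hc₁, hB₁] at hk
    exact hk
  · have hk := (key t ht).2
    rw [hc₂, hB₂] at hk
    exact hk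
  · refine ⟨max (2 * B₁ ^ 2 / (1 - c₁ ^ 2)) (2 * B₂ ^ 2 / (1 - c₂ ^ 2)), fun t ht => ?_⟩
    obtain ⟨n₁, n₂⟩ := hM.ne_zero t ht
    exact ⟨(norm_le_of_boundedBy (v := v₁ t) hc₁0 hc₁1 n₁ (key t ht).1).trans (le_max_left _ _),
      (norm_le_of_boundedBy (v := v₂ t) hc₂0 hc₂1 n₂ (key t ht).2).trans (le_max_right _ _)⟩

end KeplerCollisions

theorem theorem5 (m₁ m₂ μ₁ μ₂ : ℝ) (hm₁ : 0 < m₁) (hm : m₁ ≤ m₂)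
    (hμ₁ : μ₁ = m₁ / (m₁ + m₂)) (hμ₂ : μ₂ = m₂ / (m₁ + m₂))
    (E ℓ : ℝ) (hE : E * ℓ ^ 2 < KeplerCollisions.sigma μ₁ μ₂) :
    -- the dynamics of the orbits
    (∃ c₁ c₂ B : ℝ, c₁ < 1 ∧ c₂ < 1 ∧
      ∀ o₁ o₂ : KeplerCollisions.Orbit, KeplerCollisions.Intersect o₁ o₂ →
        KeplerCollisions.meanEnergy μ₁ μ₂ o₁ o₂ = E →
        ‖KeplerCollisions.meanAngMom μ₁ μ₂ o₁ o₂‖ = ℓ →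
        ∀ o₁' o₂' : KeplerCollisions.Orbit,
          Relation.ReflTransGen (KeplerCollisions.OrbitStep μ₁ μ₂) (o₁, o₂) (o₁', o₂') →
          KeplerCollisions.Intersect o₁' o₂' ∧
          KeplerCollisions.meanEnergy μ₁ μ₂ o₁' o₂'
              * ‖KeplerCollisions.meanAngMom μ₁ μ₂ o₁' o₂'‖ ^ 2
            < KeplerCollisions.sigma μ₁ μ₂ ∧
          o₁'.IsElliptic ∧ o₂'.IsElliptic ∧ o₁'.ecc ≤ c₁ ∧ o₂'.ecc ≤ c₂ ∧
          ‖o₁'.angMom‖ ≤ B ∧ ‖o₂'.angMom‖ ≤ B) ∧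
    -- two hard spheres
    (∃ D₀ c₁ c₂ B : ℝ, 0 < D₀ ∧ c₁ < 1 ∧ c₂ < 1 ∧
      ∀ R₁ R₂ : ℝ, 0 ≤ R₁ → 0 ≤ R₂ → 0 < R₁ + R₂ → R₁ + R₂ ≤ D₀ →
      ∀ (I C : Set ℝ) (x₁ x₂ u₁ u₂ v₁ v₂ : ℝ → KeplerCollisions.E3),
        KeplerCollisions.HardSphereMotion μ₁ μ₂ (R₁ + R₂) I C x₁ x₂ u₁ u₂ v₁ v₂ →
        (KeplerCollisions.osculating (x₁ 0) (u₁ 0)).IsElliptic →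
        (KeplerCollisions.osculating (x₂ 0) (u₂ 0)).IsElliptic →
        KeplerCollisions.meanEnergy μ₁ μ₂ (KeplerCollisions.osculating (x₁ 0) (u₁ 0))
          (KeplerCollisions.osculating (x₂ 0) (u₂ 0)) = E →
        ‖KeplerCollisions.meanAngMom μ₁ μ₂ (KeplerCollisions.osculating (x₁ 0) (u₁ 0))
          (KeplerCollisions.osculating (x₂ 0) (u₂ 0))‖ = ℓ →
        ∀ t ∈ I, ∀ w₁ w₂ : KeplerCollisions.E3,
          (w₁ = u₁ t ∧ w₂ = u₂ t) ∨ (w₁ = v₁ t ∧ w₂ = v₂ t) →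
          KeplerCollisions.meanEnergy μ₁ μ₂ (KeplerCollisions.osculating (x₁ t) w₁)
                (KeplerCollisions.osculating (x₂ t) w₂)
              * ‖KeplerCollisions.meanAngMom μ₁ μ₂ (KeplerCollisions.osculating (x₁ t) w₁)
                (KeplerCollisions.osculating (x₂ t) w₂)‖ ^ 2
            < KeplerCollisions.sigma μ₁ μ₂ ∧
          KeplerCollisions.Orbit.Controlled c₁ B (KeplerCollisions.osculating (x₁ 0) (u₁ 0))
            (KeplerCollisions.osculating (x₁ t) w₁) ∧
          KeplerCollisions.Orbit.Controlled c₂ B (KeplerCollisions.osculating (x₂ 0) (u₂ 0))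
            (KeplerCollisions.osculating (x₂ t) w₂)) ∧
    -- two point particles with a short-range interaction
    (∃ D₀ U₀ c₁ c₂ B : ℝ, 0 < D₀ ∧ 0 < U₀ ∧ c₁ < 1 ∧ c₂ < 1 ∧
      ∀ (D U : ℝ) (V : ℝ → ℝ), 0 < D → D ≤ D₀ → 0 ≤ U → U ≤ U₀ →
        (∀ r, D ≤ r → V r = 0) → (∀ r, 0 < r → -U ≤ V r) →
      ∀ (I : Set ℝ) (x₁ x₂ v₁ v₂ : ℝ → KeplerCollisions.E3),
        KeplerCollisions.PotentialMotion m₁ m₂ V I x₁ x₂ v₁ v₂ →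
        (KeplerCollisions.osculating (x₁ 0) (v₁ 0)).IsElliptic →
        (KeplerCollisions.osculating (x₂ 0) (v₂ 0)).IsElliptic →
        KeplerCollisions.interactingEnergy m₁ m₂ V (x₁ 0) (x₂ 0) (v₁ 0) (v₂ 0) = E →
        ‖KeplerCollisions.meanAngMom μ₁ μ₂ (KeplerCollisions.osculating (x₁ 0) (v₁ 0))
          (KeplerCollisions.osculating (x₂ 0) (v₂ 0))‖ = ℓ →
        (∀ t ∈ I,
          KeplerCollisions.interactingEnergy m₁ m₂ V (x₁ t) (x₂ t) (v₁ t) (v₂ t)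
              * ‖KeplerCollisions.meanAngMom μ₁ μ₂ (KeplerCollisions.osculating (x₁ t) (v₁ t))
                (KeplerCollisions.osculating (x₂ t) (v₂ t))‖ ^ 2
            < KeplerCollisions.sigma μ₁ μ₂ ∧
          KeplerCollisions.Orbit.Controlled c₁ B (KeplerCollisions.osculating (x₁ 0) (v₁ 0))
            (KeplerCollisions.osculating (x₁ t) (v₁ t)) ∧
          KeplerCollisions.Orbit.Controlled c₂ B (KeplerCollisions.osculating (x₂ 0) (v₂ 0))
            (KeplerCollisions.osculating (x₂ t) (v₂ t))) ∧
        ∃ R : ℝ, ∀ t ∈ I, ‖x₁ t‖ ≤ R ∧ ‖x₂ t‖ ≤ R) := by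
  have hm₂ : 0 < m₂ := hm₁.trans_le hm
  have h₁ : 0 < μ₁ := by rw [hμ₁]; positivity
  have h : μ₁ ≤ μ₂ := by rw [hμ₁, hμ₂]; gcongr
  have h12 : μ₁ + μ₂ = 1 := by rw [hμ₁, hμ₂]; field_simp
  refine ⟨KeplerCollisions.orbits_bounded h₁ h h12 hE,
    KeplerCollisions.hardSpheres_bounded h₁ h h12 hE, ?_⟩
  subst hμ₁ hμ₂
  exact KeplerCollisions.pointParticles_bounded hm₁ hm hE
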